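/- Let $\mathbb H_{m,d}$ be the space of real homogeneous polynomials of degree $m$ in $d$ variables ($m,d\ge 2$). For a non-degenerate $d$-simplex $T\subset\mathbb R^d$ and a continuous function $v$ on $T$, let $I_{m,T}v$ be the polynomial of total degree at most $m-1$ that agrees with $v$ at all points of $T$ whose barycentric coordinates lie in $\{0,\frac1{m-1},\frac2{m-1},\dots,1\}$. Define the shape function $$K_{m,d}(\pi)=\inf_{|T|=1}\|\pi-I_{m,T}\pi\|_{L^\infty(T)},\qquad \pi\in\mathbb H_{m,d},$$ the infimum being over all $d$-simplices $T$ of volume $1$. The pair $(m,d)$ is called compatible if, for every $\pi\in\mathbb H_{m,d}$ for which there are complex $d\times d$ matrices $\phi_n$ with $\det\phi_n=1$ and $\pi\circ\phi_n\to0$, there are also real $d\times d$ matrices $\psi_n$ with $\det\psi_n=1$ and $\pi\circ\psi_n\to0$. Write a real ternary cubic form as $$\pi=ax^3+by^3+cz^3+3a_2x^2y+3a_3x^2z+3b_1xy^2+3b_3y^2z+3c_1xz^2+3c_2yz^2+6m\,xyz,$$ and let $S(\pi)$ and $T(\pi)$ be its classical Aronhold invariants, of degree $4$ and $6$ in the coefficients,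 in Salmon's normalization: $S$ and $T$ are the polynomials in the coefficients with $S(\pi\circ\phi)=(\det\phi)^4S(\pi)$, $T(\pi\circ\phi)=(\det\phi)^6T(\pi)$ for all real $3\times3$ matrices $\phi$, and with $S=m-m^4$, $T=1-20m^3-8m^6$ for $\pi=x^3+y^3+z^3+6m\,xyz$. Corollary. There are constants $0<c\le C$ such that for all $\pi\in\mathbb H_{3,3}$ $$c\,\bigl(|S(\pi)|^3+T(\pi)^2\bigr)^{1/12}\;\le\;K_{3,3}(\pi)\;\le\;C\,\bigl(|S(\pi)|^3+T(\pi)^2\bigr)^{1/12}.$$ Moreover, the pair $(3,3)$ is compatible. -/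

import Mathlib

open MeasureTheory Filter Topology
open scoped ENNReal

/-! ### Homogeneous forms and linear changes of coordinates

The space of homogeneous polynomials of degree `m` in `d` variables over `R` is represented by the
`π : MvPolynomial (Fin d) R` with `π.IsHomogeneous m`. -/

/-- The form `π ∘ φ`, i.e. `z ↦ π (φ z)`, for a `d × d` matrix `φ`. -/
noncomputable def compMatrix {R : Type*} [CommRing R] {d : ℕ}
    (π : MvPolynomial (Fin d) R) (φ : Matrix (Fin d) (Fin d) R) : MvPolynomial (Fin d) R :=
  MvPolynomial.bind₁ (fun i => ∑ j, MvPolynomial.C (φ i j) * MvPolynomial.X j) π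

/-- Convergence to `0` of a sequence of polynomials, in the sense of coefficients (on the finite
dimensional space of forms of a given degree this is convergence for any norm). -/
def TendstoZeroCoeff {R : Type*} [CommRing R] [TopologicalSpace R] {d : ℕ}
    (P : ℕ → MvPolynomial (Fin d) R) : Prop :=
  ∀ s : Fin d →₀ ℕ, Tendsto (fun n => (P n).coeff s) atTop (𝓝 0)

/-- The pair `(m, d)` is compatible: every real form of degree `m` in `d` variables which can be sent
to `0` by complex matrices of determinant one can also be sent to `0` by real matrices of
determinant one. -/
def IsCompatiblePair (m d : ℕ) : Prop :=
  ∀ π : MvPolynomial (Fin d) ℝ, π.IsHomogeneous m →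
    (∃ φ : ℕ → Matrix (Fin d) (Fin d) ℂ, (∀ n, (φ n).det = 1) ∧
      TendstoZeroCoeff (fun n => compMatrix (MvPolynomial.map (algebraMap ℝ ℂ) π) (φ n))) →
    ∃ ψ : ℕ → Matrix (Fin d) (Fin d) ℝ, (∀ n, (ψ n).det = 1) ∧
      TendstoZeroCoeff (fun n => compMatrix π (ψ n))

/-! ### Lagrange interpolation on simplices and the shape function -/

/-- The function on Euclidean space defined by a polynomial. -/
noncomputable def polyFun {d : ℕ} (π : MvPolynomial (Fin d) ℝ) (z : EuclideanSpace ℝ (Fin d)) : ℝ :=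
  MvPolynomial.eval (fun i => z i) π

/-- The closed solid `d`-dimensional simplex with the (affinely independent) vertices of `T`. -/
def solid {d : ℕ} (T : Affine.Simplex ℝ (EuclideanSpace ℝ (Fin d)) d) :
    Set (EuclideanSpace ℝ (Fin d)) :=
  convexHull ℝ (Set.range T.points)

/-- The interpolation nodes of degree `m - 1` (for `m ≥ 2`): the points of the simplex whose
barycentric coordinates all lie in `{0, 1/(m-1), 2/(m-1), …, 1}`. -/
def lagrangeNodes (m : ℕ) {d : ℕ} (T : Affine.Simplex ℝ (EuclideanSpace ℝ (Fin d)) d) :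
    Set (EuclideanSpace ℝ (Fin d)) :=
  {γ | ∃ k : Fin (d + 1) → ℕ, ∑ i, k i = m - 1 ∧
    γ = ∑ i, ((k i : ℝ) / ((m - 1 : ℕ) : ℝ)) • T.points i}

/-- `q = I_{m,T} v`: the polynomial `q` has total degree at most `m - 1` and agrees with `v` at all
the interpolation nodes (these conditions determine `q`). -/
def IsLagrangeInterpolant (m : ℕ) {d : ℕ} (T : Affine.Simplex ℝ (EuclideanSpace ℝ (Fin d)) d)
    (v : EuclideanSpace ℝ (Fin d) → ℝ) (q : MvPolynomial (Fin d) ℝ) : Prop :=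
  q.totalDegree ≤ m - 1 ∧ ∀ γ ∈ lagrangeNodes m T, polyFun q γ = v γ

/-- The shape function `K_{m,p,d}(π)`: the infimum of the interpolation error
`‖π - I_{m,T} π‖_{L^p(T)}` over all `d`-dimensional simplices `T` of volume one. -/
noncomputable def shapeFunctionLp (m d : ℕ) (p : ℝ≥0∞) (π : MvPolynomial (Fin d) ℝ) : ℝ :=
  sInf {e : ℝ | ∃ T : Affine.Simplex ℝ (EuclideanSpace ℝ (Fin d)) d, volume (solid T) = 1 ∧
    ∃ q : MvPolynomial (Fin d) ℝ, IsLagrangeInterpolant m T (polyFun π) q ∧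
      e = (eLpNorm (fun z => polyFun π z - polyFun q z) p (volume.restrict (solid T))).toReal}

/-- The shape function `K_{m,d} = K_{m,∞,d}`. -/
noncomputable def shapeFunction (m d : ℕ) (π : MvPolynomial (Fin d) ℝ) : ℝ :=
  shapeFunctionLp m d ∞ π

/-! ### The Aronhold invariants of a ternary cubic -/

/-- The coefficients of a ternary cubic with their multinomial factors removed: the form is
`a x³ + b y³ + c z³ + 3 a₂ x²y + 3 a₃ x²z + 3 b₁ xy² + 3 b₃ y²z + 3 c₁ xz² + 3 c₂ yz² + 6 m xyz`,
with `x, y, z` the variables of index `0, 1, 2`. -/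
structure CubicCoeffs where
  (a b c a₂ a₃ b₁ b₃ c₁ c₂ m : ℝ)

/-- The coefficient of `x^i y^j z^k`. -/
noncomputable def ternaryCoeff (π : MvPolynomial (Fin 3) ℝ) (i j k : ℕ) : ℝ :=
  π.coeff (Finsupp.single 0 i + Finsupp.single 1 j + Finsupp.single 2 k)

/-- The normalized coefficients of a ternary cubic form. -/
noncomputable def cubicCoeffs (π : MvPolynomial (Fin 3) ℝ) : CubicCoeffs where
  a := ternaryCoeff π 3 0 0
  b := ternaryCoeff π 0 3 0
  c := ternaryCoeff π 0 0 3
  a₂ := ternaryCoeff π 2 1 0 / 3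
  a₃ := ternaryCoeff π 2 0 1 / 3
  b₁ := ternaryCoeff π 1 2 0 / 3
  b₃ := ternaryCoeff π 0 2 1 / 3
  c₁ := ternaryCoeff π 1 0 2 / 3
  c₂ := ternaryCoeff π 0 1 2 / 3
  m := ternaryCoeff π 1 1 1 / 6

/-- The Aronhold invariant `S`, of degree `4`, in Salmon's expression. -/
def CubicCoeffs.S : CubicCoeffs → ℝ
  | ⟨a, b, c, a₂, a₃, b₁, b₃, c₁, c₂, m⟩ =>
    a * b * c * m
      - (b * c * a₂ * a₃ + c * a * b₁ * b₃ + a * b * c₁ * c₂)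
      - m * (a * b₃ * c₂ + b * c₁ * a₃ + c * a₂ * b₁)
      + (a * b₁ * c₂ ^ 2 + a * c₁ * b₃ ^ 2 + b * a₂ * c₁ ^ 2 + b * c₂ * a₃ ^ 2
          + c * b₃ * a₂ ^ 2 + c * a₃ * b₁ ^ 2)
      - m ^ 4 + 2 * m ^ 2 * (b₁ * c₁ + c₂ * a₂ + a₃ * b₃)
      - 3 * m * (a₂ * b₃ * c₁ + a₃ * b₁ * c₂)
      - (b₁ ^ 2 * c₁ ^ 2 + c₂ ^ 2 * a₂ ^ 2 + a₃ ^ 2 * b₃ ^ 2)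
      + (c₂ * a₂ * a₃ * b₃ + a₃ * b₃ * b₁ * c₁ + b₁ * c₁ * c₂ * a₂)

/-- The Aronhold invariant `T`, of degree `6`, in Salmon's expression. -/
def CubicCoeffs.T : CubicCoeffs → ℝ
  | ⟨a, b, c, a₂, a₃, b₁, b₃, c₁, c₂, m⟩ =>
    a ^ 2 * b ^ 2 * c ^ 2
      - 6 * a * b * c * (a * b₃ * c₂ + b * c₁ * a₃ + c * a₂ * b₁)
      - 20 * a * b * c * m ^ 3
      + 12 * a * b * c * m * (b₁ * c₁ + c₂ * a₂ + a₃ * b₃)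
      + 6 * a * b * c * (a₂ * b₃ * c₁ + a₃ * b₁ * c₂)
      + 4 * (a ^ 2 * b * c₂ ^ 3 + a ^ 2 * c * b₃ ^ 3 + b ^ 2 * c * a₃ ^ 3
          + b ^ 2 * a * c₁ ^ 3 + c ^ 2 * a * b₁ ^ 3 + c ^ 2 * b * a₂ ^ 3)
      + 36 * m ^ 2 * (b * c * a₂ * a₃ + c * a * b₁ * b₃ + a * b * c₁ * c₂)
      - 24 * m * (b * c * b₁ * a₃ ^ 2 + b * c * c₁ * a₂ ^ 2 + c * a * c₂ * b₁ ^ 2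
          + c * a * a₂ * b₃ ^ 2 + a * b * a₃ * c₂ ^ 2 + a * b * b₃ * c₁ ^ 2)
      - 3 * (a ^ 2 * b₃ ^ 2 * c₂ ^ 2 + b ^ 2 * c₁ ^ 2 * a₃ ^ 2 + c ^ 2 * a₂ ^ 2 * b₁ ^ 2)
      + 18 * (b * c * b₁ * c₁ * a₂ * a₃ + c * a * c₂ * a₂ * b₃ * b₁ + a * b * a₃ * b₃ * c₁ * c₂)
      - 12 * (b * c * c₂ * a₃ * a₂ ^ 2 + b * c * b₃ * a₂ * a₃ ^ 2 + c * a * c₁ * b₃ * b₁ ^ 2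
          + c * a * a₃ * b₁ * b₃ ^ 2 + a * b * a₂ * c₁ * c₂ ^ 2 + a * b * b₁ * c₂ * c₁ ^ 2)
      - 12 * m ^ 3 * (a * b₃ * c₂ + b * c₁ * a₃ + c * a₂ * b₁)
      + 12 * m ^ 2 * (a * b₁ * c₂ ^ 2 + a * c₁ * b₃ ^ 2 + b * a₂ * c₁ ^ 2 + b * c₂ * a₃ ^ 2
          + c * b₃ * a₂ ^ 2 + c * a₃ * b₁ ^ 2)
      - 60 * m * (a * b₁ * b₃ * c₁ * c₂ + b * c₁ * c₂ * a₂ * a₃ + c * a₂ * a₃ * b₁ * b₃)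
      + 12 * m * (a * a₂ * b₃ * c₂ ^ 2 + a * a₃ * c₂ * b₃ ^ 2 + b * b₃ * c₁ * a₃ ^ 2
          + b * b₁ * a₃ * c₁ ^ 2 + c * c₁ * a₂ * b₁ ^ 2 + c * c₂ * b₁ * a₂ ^ 2)
      + 6 * (a * b₃ * c₂ + b * c₁ * a₃ + c * a₂ * b₁) * (a₂ * b₃ * c₁ + a₃ * b₁ * c₂)
      + 24 * (a * b₁ * b₃ ^ 2 * c₁ ^ 2 + a * c₁ * c₂ ^ 2 * b₁ ^ 2 + b * c₂ * c₁ ^ 2 * a₂ ^ 2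
          + b * a₂ * a₃ ^ 2 * c₂ ^ 2 + c * a₃ * a₂ ^ 2 * b₃ ^ 2 + c * b₃ * b₁ ^ 2 * a₃ ^ 2)
      - 12 * (a * a₂ * b₁ * c₂ ^ 3 + a * a₃ * c₁ * b₃ ^ 3 + b * b₃ * c₂ * a₃ ^ 3
          + b * b₁ * a₂ * c₁ ^ 3 + c * c₁ * a₃ * b₁ ^ 3 + c * c₂ * b₃ * a₂ ^ 3)
      - 8 * m ^ 6 + 24 * m ^ 4 * (b₁ * c₁ + c₂ * a₂ + a₃ * b₃)
      - 36 * m ^ 3 * (a₂ * b₃ * c₁ + a₃ * b₁ * c₂)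
      - 12 * m ^ 2 * (b₁ * c₁ * c₂ * a₂ + c₂ * a₂ * a₃ * b₃ + a₃ * b₃ * b₁ * c₁)
      - 24 * m ^ 2 * (b₁ ^ 2 * c₁ ^ 2 + c₂ ^ 2 * a₂ ^ 2 + a₃ ^ 2 * b₃ ^ 2)
      + 36 * m * (a₂ * b₃ * c₁ + a₃ * b₁ * c₂) * (b₁ * c₁ + c₂ * a₂ + a₃ * b₃)
      + 8 * (b₁ ^ 3 * c₁ ^ 3 + c₂ ^ 3 * a₂ ^ 3 + a₃ ^ 3 * b₃ ^ 3)
      - 27 * (a₂ ^ 2 * b₃ ^ 2 * c₁ ^ 2 + a₃ ^ 2 * b₁ ^ 2 * c₂ ^ 2)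
      - 6 * b₁ * c₁ * c₂ * a₂ * a₃ * b₃
      - 12 * (b₁ ^ 2 * c₁ ^ 2 * c₂ * a₂ + b₁ ^ 2 * c₁ ^ 2 * a₃ * b₃ + c₂ ^ 2 * a₂ ^ 2 * a₃ * b₃
          + c₂ ^ 2 * a₂ ^ 2 * b₁ * c₁ + a₃ ^ 2 * b₃ ^ 2 * b₁ * c₁ + a₃ ^ 2 * b₃ ^ 2 * c₂ * a₂)

/-- The Aronhold invariant `S` of a ternary cubic form. -/
noncomputable def aronholdS (π : MvPolynomial (Fin 3) ℝ) : ℝ := (cubicCoeffs π).S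

/-- The Aronhold invariant `T` of a ternary cubic form. -/
noncomputable def aronholdT (π : MvPolynomial (Fin 3) ℝ) : ℝ := (cubicCoeffs π).T

/-! ### Ternary cubics in terms of their normalized coefficients -/

/-! The height H = |S|^3 + T^2 has degree 12 in the coefficients and is multiplied by |det g|^12
under substitution of g. Its twelfth root is thus an SL3-invariant with the same homogeneity as the
interpolation error.

Up to translation, a simplex of volume one is the image of the standard simplex under a matrix A
with |det A| fixed. The error on it is comparable with the norm of the coefficients of π∘A. The
upper estimate comes from an explicit interpolant on the standard simplex
(`exists_interpolant_matrixSimplex`). The lower one comes from third differences along the edges,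
which annihilate the quadratic interpolant and recover the polar form of π
(`norm_cubicAct_edgeMatrix_le`). Hence K(π) is comparable with the infimum of ‖π∘g‖ over unimodular
g, and this infimum has to be compared with H^(1/12).

Homogeneity and compactness of the unit sphere give H ≤ M‖·‖^12, whence the lower bound for K. For
the upper bound, the forms of norm one that are minimal in their SL3-orbit up to a factor 2 form a
compact set. If H has no zero there, it is bounded below there by some δ > 0
(`exists_aronholdHeight_ge_of_almost_minimal`).

What makes this work is the real null cone theorem `isUnstableCubic_of_invariants_eq_zero`: a real
cubic with S = T = 0 can be sent to 0 by real unimodular matrices. Such a cubic has a real point,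
since its degree is odd. In coordinates adapted to that point, S = T = 0 forces a real singular
point whose tangent cone is a double line or vanishes, and a diagonal one-parameter family contracts
the form. Compatibility follows too, because S and T vanish on every form that complex unimodular
matrices send to 0. -/

section Forms

variable {R : Type*}

/-- The ternary cubic form with normalized coefficients
`a, b, c, a₂, a₃, b₁, b₃, c₁, c₂, m`, in this order. -/
noncomputable def ternaryCubic [CommRing R] (v : Fin 10 → R) : MvPolynomial (Fin 3) R :=
  MvPolynomial.C (v 0) * MvPolynomial.X 0 ^ 3 + MvPolynomial.C (v 1) * MvPolynomial.X 1 ^ 3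
    + MvPolynomial.C (v 2) * MvPolynomial.X 2 ^ 3
    + 3 * MvPolynomial.C (v 3) * (MvPolynomial.X 0 ^ 2 * MvPolynomial.X 1)
    + 3 * MvPolynomial.C (v 4) * (MvPolynomial.X 0 ^ 2 * MvPolynomial.X 2)
    + 3 * MvPolynomial.C (v 5) * (MvPolynomial.X 0 * MvPolynomial.X 1 ^ 2)
    + 3 * MvPolynomial.C (v 6) * (MvPolynomial.X 1 ^ 2 * MvPolynomial.X 2)
    + 3 * MvPolynomial.C (v 7) * (MvPolynomial.X 0 * MvPolynomial.X 2 ^ 2)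
    + 3 * MvPolynomial.C (v 8) * (MvPolynomial.X 1 * MvPolynomial.X 2 ^ 2)
    + 6 * MvPolynomial.C (v 9) * (MvPolynomial.X 0 * MvPolynomial.X 1 * MvPolynomial.X 2)

/-- The exponent vector of `x ^ i * y ^ j * z ^ k`. -/
noncomputable def ternaryExp (i j k : ℕ) : Fin 3 →₀ ℕ :=
  Finsupp.single 0 i + Finsupp.single 1 j + Finsupp.single 2 k

/-- The normalized coefficients of a ternary cubic. -/
noncomputable def normCoeffs [Field R] (π : MvPolynomial (Fin 3) R) : Fin 10 → R :=
  ![π.coeff (ternaryExp 3 0 0), π.coeff (ternaryExp 0 3 0), π.coeff (ternaryExp 0 0 3),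
    π.coeff (ternaryExp 2 1 0) / 3, π.coeff (ternaryExp 2 0 1) / 3,
    π.coeff (ternaryExp 1 2 0) / 3, π.coeff (ternaryExp 0 2 1) / 3,
    π.coeff (ternaryExp 1 0 2) / 3, π.coeff (ternaryExp 0 1 2) / 3,
    π.coeff (ternaryExp 1 1 1) / 6]

/-- The symmetric trilinear form whose restriction to the diagonal is the cubic. -/
def polarForm [CommRing R] (v : Fin 10 → R) (u w s : Fin 3 → R) : R :=
  v 0 * (u 0 * w 0 * s 0) + v 1 * (u 1 * w 1 * s 1) + v 2 * (u 2 * w 2 * s 2)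
    + v 3 * (u 0 * w 0 * s 1 + u 0 * w 1 * s 0 + u 1 * w 0 * s 0)
    + v 4 * (u 0 * w 0 * s 2 + u 0 * w 2 * s 0 + u 2 * w 0 * s 0)
    + v 5 * (u 0 * w 1 * s 1 + u 1 * w 0 * s 1 + u 1 * w 1 * s 0)
    + v 6 * (u 1 * w 1 * s 2 + u 1 * w 2 * s 1 + u 2 * w 1 * s 1)
    + v 7 * (u 0 * w 2 * s 2 + u 2 * w 0 * s 2 + u 2 * w 2 * s 0)
    + v 8 * (u 1 * w 2 * s 2 + u 2 * w 1 * s 2 + u 2 * w 2 * s 1)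
    + v 9 * (u 0 * w 1 * s 2 + u 0 * w 2 * s 1 + u 1 * w 0 * s 2 + u 1 * w 2 * s 0
      + u 2 * w 0 * s 1 + u 2 * w 1 * s 0)

/-- The action of matrices on normalized coefficients induced by linear substitution. -/
def cubicAct [CommRing R] (v : Fin 10 → R) (g : Matrix (Fin 3) (Fin 3) R) : Fin 10 → R :=
  ![polarForm v (fun i => g i 0) (fun i => g i 0) (fun i => g i 0),
    polarForm v (fun i => g i 1) (fun i => g i 1) (fun i => g i 1),
    polarForm v (fun i => g i 2) (fun i => g i 2) (fun i => g i 2),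
    polarForm v (fun i => g i 0) (fun i => g i 0) (fun i => g i 1),
    polarForm v (fun i => g i 0) (fun i => g i 0) (fun i => g i 2),
    polarForm v (fun i => g i 0) (fun i => g i 1) (fun i => g i 1),
    polarForm v (fun i => g i 1) (fun i => g i 1) (fun i => g i 2),
    polarForm v (fun i => g i 0) (fun i => g i 2) (fun i => g i 2),
    polarForm v (fun i => g i 1) (fun i => g i 2) (fun i => g i 2),
    polarForm v (fun i => g i 0) (fun i => g i 1) (fun i => g i 2)]

theorem ternaryExp_inj {i j k i' j' k' : ℕ} :
    ternaryExp i j k = ternaryExp i' j' k' ↔ i = i' ∧ j = j' ∧ k = k' := by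
  constructor
  · intro h
    have h0 := DFunLike.congr_fun h 0
    have h1 := DFunLike.congr_fun h 1
    have h2 := DFunLike.congr_fun h 2
    simp [ternaryExp] at h0 h1 h2
    exact ⟨h0, h1, h2⟩
  · rintro ⟨rfl, rfl, rfl⟩
    rfl

theorem ternaryExp_eq (s : Fin 3 →₀ ℕ) : s = ternaryExp (s 0) (s 1) (s 2) := by
  ext i
  fin_cases i <;> simp [ternaryExp]

theorem ternaryCubic_eq_sum_monomial [CommRing R] (v : Fin 10 → R) :
    ternaryCubic v = MvPolynomial.monomial (ternaryExp 3 0 0) (v 0)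
      + MvPolynomial.monomial (ternaryExp 0 3 0) (v 1)
      + MvPolynomial.monomial (ternaryExp 0 0 3) (v 2)
      + MvPolynomial.monomial (ternaryExp 2 1 0) (3 * v 3)
      + MvPolynomial.monomial (ternaryExp 2 0 1) (3 * v 4)
      + MvPolynomial.monomial (ternaryExp 1 2 0) (3 * v 5)
      + MvPolynomial.monomial (ternaryExp 0 2 1) (3 * v 6)
      + MvPolynomial.monomial (ternaryExp 1 0 2) (3 * v 7)
      + MvPolynomial.monomial (ternaryExp 0 1 2) (3 * v 8)
      + MvPolynomial.monomial (ternaryExp 1 1 1) (6 * v 9) := by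
  have key : ∀ (i j k : ℕ) (r : R), MvPolynomial.monomial (ternaryExp i j k) r
      = MvPolynomial.C r * (MvPolynomial.X 0 ^ i * MvPolynomial.X 1 ^ j * MvPolynomial.X 2 ^ k) := by
    intro i j k r
    simp [MvPolynomial.X_pow_eq_monomial, MvPolynomial.monomial_mul, MvPolynomial.C_mul_monomial,
      ternaryExp]
  simp only [key, ternaryCubic, map_mul, pow_zero, pow_one, mul_one, one_mul, map_ofNat]

theorem coeff_ternaryCubic [CommRing R] (v : Fin 10 → R) (i j k : ℕ) :
    (ternaryCubic v).coeff (ternaryExp i j k) =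
      (if 3 = i ∧ 0 = j ∧ 0 = k then v 0 else 0) + (if 0 = i ∧ 3 = j ∧ 0 = k then v 1 else 0)
      + (if 0 = i ∧ 0 = j ∧ 3 = k then v 2 else 0) + (if 2 = i ∧ 1 = j ∧ 0 = k then 3 * v 3 else 0)
      + (if 2 = i ∧ 0 = j ∧ 1 = k then 3 * v 4 else 0)
      + (if 1 = i ∧ 2 = j ∧ 0 = k then 3 * v 5 else 0)
      + (if 0 = i ∧ 2 = j ∧ 1 = k then 3 * v 6 else 0)
      + (if 1 = i ∧ 0 = j ∧ 2 = k then 3 * v 7 else 0)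
      + (if 0 = i ∧ 1 = j ∧ 2 = k then 3 * v 8 else 0)
      + (if 1 = i ∧ 1 = j ∧ 1 = k then 6 * v 9 else 0) := by
  rw [ternaryCubic_eq_sum_monomial]
  simp only [MvPolynomial.coeff_add, MvPolynomial.coeff_monomial, ternaryExp_inj]

theorem normCoeffs_ternaryCubic [Field R] [CharZero R] (v : Fin 10 → R) :
    normCoeffs (ternaryCubic v) = v := by
  ext i
  fin_cases i <;> simp [normCoeffs, coeff_ternaryCubic]

theorem ternaryCubic_normCoeffs [Field R] [CharZero R] {π : MvPolynomial (Fin 3) R}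
    (hπ : π.IsHomogeneous 3) : ternaryCubic (normCoeffs π) = π := by
  ext s
  rw [ternaryExp_eq s]
  generalize s 0 = i
  generalize s 1 = j
  generalize s 2 = k
  rw [coeff_ternaryCubic]
  by_cases h : i + j + k = 3
  · have hi : i ≤ 3 := by omega
    have hj : j ≤ 3 := by omega
    interval_cases i <;> interval_cases j <;>
      obtain rfl : k = _ := by
        first
        | exact (by omega : k = 0)
        | exact (by omega : k = 1)
        | exact (by omega : k = 2)
        | exact (by omega : k = 3)
    all_goals first | omega | (simp [normCoeffs]; try field_simp)
  · rw [hπ.coeff_eq_zero]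
    · repeat rw [if_neg (by omega)]
      simp
    · simpa [ternaryExp, Finsupp.degree_eq_sum, Fin.sum_univ_three] using h

/-- Normalized coefficients are the values of the polar form on triples of basis vectors;
substituting g replaces the basis vectors by the columns of g. -/
theorem compMatrix_ternaryCubic [CommRing R] (v : Fin 10 → R) (g : Matrix (Fin 3) (Fin 3) R) :
    compMatrix (ternaryCubic v) g = ternaryCubic (cubicAct v g) := by
  simp only [compMatrix, ternaryCubic, map_add, map_mul, map_pow, MvPolynomial.bind₁_X_right,
    MvPolynomial.bind₁_C_right, map_ofNat, Fin.sum_univ_three]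
  simp [cubicAct, polarForm]
  ring

theorem compMatrix_mul [CommRing R] {d : ℕ} (π : MvPolynomial (Fin d) R)
    (g h : Matrix (Fin d) (Fin d) R) :
    compMatrix π (g * h) = compMatrix (compMatrix π g) h := by
  unfold compMatrix
  rw [MvPolynomial.bind₁_bind₁]
  congr 2
  funext i
  simp only [map_sum, map_mul, MvPolynomial.bind₁_X_right, MvPolynomial.bind₁_C_right,
    Matrix.mul_apply, Finset.mul_sum, Finset.sum_mul]
  rw [Finset.sum_comm]
  simp only [mul_assoc]

/-- Functoriality is inherited from substitution in polynomials, since normalized coefficients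
determine the form. -/
theorem cubicAct_mul [Field R] [CharZero R] (v : Fin 10 → R) (g h : Matrix (Fin 3) (Fin 3) R) :
    cubicAct v (g * h) = cubicAct (cubicAct v g) h := by
  rw [← normCoeffs_ternaryCubic (cubicAct v (g * h)), ← compMatrix_ternaryCubic, compMatrix_mul,
    compMatrix_ternaryCubic, compMatrix_ternaryCubic, normCoeffs_ternaryCubic]

end Forms

/-! ### Invariance of the Aronhold invariants -/

/-- The Aronhold invariant `S` in terms of normalized coefficients, over any commutative ring. -/
def salmonS {R : Type*} [CommRing R] (v : Fin 10 → R) : R :=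
  v 0 * v 1 * v 2 * v 9
    - (v 1 * v 2 * v 3 * v 4 + v 2 * v 0 * v 5 * v 6 + v 0 * v 1 * v 7 * v 8)
    - v 9 * (v 0 * v 6 * v 8 + v 1 * v 7 * v 4 + v 2 * v 3 * v 5)
    + (v 0 * v 5 * v 8 ^ 2 + v 0 * v 7 * v 6 ^ 2 + v 1 * v 3 * v 7 ^ 2 + v 1 * v 8 * v 4 ^ 2
        + v 2 * v 6 * v 3 ^ 2 + v 2 * v 4 * v 5 ^ 2)
    - v 9 ^ 4 + 2 * v 9 ^ 2 * (v 5 * v 7 + v 8 * v 3 + v 4 * v 6)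
    - 3 * v 9 * (v 3 * v 6 * v 7 + v 4 * v 5 * v 8)
    - (v 5 ^ 2 * v 7 ^ 2 + v 8 ^ 2 * v 3 ^ 2 + v 4 ^ 2 * v 6 ^ 2)
    + (v 8 * v 3 * v 4 * v 6 + v 4 * v 6 * v 5 * v 7 + v 5 * v 7 * v 8 * v 3)

/-- The Aronhold invariant `T` in terms of normalized coefficients, over any commutative ring. -/
def salmonT {R : Type*} [CommRing R] (v : Fin 10 → R) : R :=
  v 0 ^ 2 * v 1 ^ 2 * v 2 ^ 2
    - 6 * v 0 * v 1 * v 2 * (v 0 * v 6 * v 8 + v 1 * v 7 * v 4 + v 2 * v 3 * v 5)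
    - 20 * v 0 * v 1 * v 2 * v 9 ^ 3
    + 12 * v 0 * v 1 * v 2 * v 9 * (v 5 * v 7 + v 8 * v 3 + v 4 * v 6)
    + 6 * v 0 * v 1 * v 2 * (v 3 * v 6 * v 7 + v 4 * v 5 * v 8)
    + 4 * (v 0 ^ 2 * v 1 * v 8 ^ 3 + v 0 ^ 2 * v 2 * v 6 ^ 3 + v 1 ^ 2 * v 2 * v 4 ^ 3
        + v 1 ^ 2 * v 0 * v 7 ^ 3 + v 2 ^ 2 * v 0 * v 5 ^ 3 + v 2 ^ 2 * v 1 * v 3 ^ 3)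
    + 36 * v 9 ^ 2 * (v 1 * v 2 * v 3 * v 4 + v 2 * v 0 * v 5 * v 6 + v 0 * v 1 * v 7 * v 8)
    - 24 * v 9 * (v 1 * v 2 * v 5 * v 4 ^ 2 + v 1 * v 2 * v 7 * v 3 ^ 2 + v 2 * v 0 * v 8 * v 5 ^ 2
        + v 2 * v 0 * v 3 * v 6 ^ 2 + v 0 * v 1 * v 4 * v 8 ^ 2 + v 0 * v 1 * v 6 * v 7 ^ 2)
    - 3 * (v 0 ^ 2 * v 6 ^ 2 * v 8 ^ 2 + v 1 ^ 2 * v 7 ^ 2 * v 4 ^ 2 + v 2 ^ 2 * v 3 ^ 2 * v 5 ^ 2)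
    + 18 * (v 1 * v 2 * v 5 * v 7 * v 3 * v 4 + v 2 * v 0 * v 8 * v 3 * v 6 * v 5 + v 0 * v 1 * v 4 * v 6 * v 7 * v 8)
    - 12 * (v 1 * v 2 * v 8 * v 4 * v 3 ^ 2 + v 1 * v 2 * v 6 * v 3 * v 4 ^ 2 + v 2 * v 0 * v 7 * v 6 * v 5 ^ 2
        + v 2 * v 0 * v 4 * v 5 * v 6 ^ 2 + v 0 * v 1 * v 3 * v 7 * v 8 ^ 2 + v 0 * v 1 * v 5 * v 8 * v 7 ^ 2)
    - 12 * v 9 ^ 3 * (v 0 * v 6 * v 8 + v 1 * v 7 * v 4 + v 2 * v 3 * v 5)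
    + 12 * v 9 ^ 2 * (v 0 * v 5 * v 8 ^ 2 + v 0 * v 7 * v 6 ^ 2 + v 1 * v 3 * v 7 ^ 2 + v 1 * v 8 * v 4 ^ 2
        + v 2 * v 6 * v 3 ^ 2 + v 2 * v 4 * v 5 ^ 2)
    - 60 * v 9 * (v 0 * v 5 * v 6 * v 7 * v 8 + v 1 * v 7 * v 8 * v 3 * v 4 + v 2 * v 3 * v 4 * v 5 * v 6)
    + 12 * v 9 * (v 0 * v 3 * v 6 * v 8 ^ 2 + v 0 * v 4 * v 8 * v 6 ^ 2 + v 1 * v 6 * v 7 * v 4 ^ 2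
        + v 1 * v 5 * v 4 * v 7 ^ 2 + v 2 * v 7 * v 3 * v 5 ^ 2 + v 2 * v 8 * v 5 * v 3 ^ 2)
    + 6 * (v 0 * v 6 * v 8 + v 1 * v 7 * v 4 + v 2 * v 3 * v 5) * (v 3 * v 6 * v 7 + v 4 * v 5 * v 8)
    + 24 * (v 0 * v 5 * v 6 ^ 2 * v 7 ^ 2 + v 0 * v 7 * v 8 ^ 2 * v 5 ^ 2 + v 1 * v 8 * v 7 ^ 2 * v 3 ^ 2
        + v 1 * v 3 * v 4 ^ 2 * v 8 ^ 2 + v 2 * v 4 * v 3 ^ 2 * v 6 ^ 2 + v 2 * v 6 * v 5 ^ 2 * v 4 ^ 2)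
    - 12 * (v 0 * v 3 * v 5 * v 8 ^ 3 + v 0 * v 4 * v 7 * v 6 ^ 3 + v 1 * v 6 * v 8 * v 4 ^ 3
        + v 1 * v 5 * v 3 * v 7 ^ 3 + v 2 * v 7 * v 4 * v 5 ^ 3 + v 2 * v 8 * v 6 * v 3 ^ 3)
    - 8 * v 9 ^ 6 + 24 * v 9 ^ 4 * (v 5 * v 7 + v 8 * v 3 + v 4 * v 6)
    - 36 * v 9 ^ 3 * (v 3 * v 6 * v 7 + v 4 * v 5 * v 8)
    - 12 * v 9 ^ 2 * (v 5 * v 7 * v 8 * v 3 + v 8 * v 3 * v 4 * v 6 + v 4 * v 6 * v 5 * v 7)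
    - 24 * v 9 ^ 2 * (v 5 ^ 2 * v 7 ^ 2 + v 8 ^ 2 * v 3 ^ 2 + v 4 ^ 2 * v 6 ^ 2)
    + 36 * v 9 * (v 3 * v 6 * v 7 + v 4 * v 5 * v 8) * (v 5 * v 7 + v 8 * v 3 + v 4 * v 6)
    + 8 * (v 5 ^ 3 * v 7 ^ 3 + v 8 ^ 3 * v 3 ^ 3 + v 4 ^ 3 * v 6 ^ 3)
    - 27 * (v 3 ^ 2 * v 6 ^ 2 * v 7 ^ 2 + v 4 ^ 2 * v 5 ^ 2 * v 8 ^ 2)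
    - 6 * v 5 * v 7 * v 8 * v 3 * v 4 * v 6
    - 12 * (v 5 ^ 2 * v 7 ^ 2 * v 8 * v 3 + v 5 ^ 2 * v 7 ^ 2 * v 4 * v 6 + v 8 ^ 2 * v 3 ^ 2 * v 4 * v 6
        + v 8 ^ 2 * v 3 ^ 2 * v 5 * v 7 + v 4 ^ 2 * v 6 ^ 2 * v 5 * v 7 + v 4 ^ 2 * v 6 ^ 2 * v 8 * v 3)

theorem salmonS_cubicAct_diagonal {R : Type*} [CommRing R] (v : Fin 10 → R) (D : Fin 3 → R) :
    salmonS (cubicAct v (Matrix.diagonal D)) = (Matrix.diagonal D).det ^ 4 * salmonS v := by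
  rw [Matrix.det_diagonal, Fin.prod_univ_three]
  simp [salmonS, cubicAct, polarForm]
  ring

theorem salmonT_cubicAct_diagonal {R : Type*} [CommRing R] (v : Fin 10 → R) (D : Fin 3 → R) :
    salmonT (cubicAct v (Matrix.diagonal D)) = (Matrix.diagonal D).det ^ 6 * salmonT v := by
  rw [Matrix.det_diagonal, Fin.prod_univ_three]
  simp [salmonT, cubicAct, polarForm]
  ring

theorem salmonS_cubicAct_transvection {R : Type*} [CommRing R] (v : Fin 10 → R) (i j : Fin 3)
    (hij : i ≠ j) (t : R) : salmonS (cubicAct v (Matrix.transvection i j t)) = salmonS v := by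
  fin_cases i <;> fin_cases j <;> first | exact absurd rfl hij | skip
  all_goals
    simp [salmonS, cubicAct, polarForm, Matrix.transvection, Matrix.single]
    ring

theorem salmonT_cubicAct_transvection {R : Type*} [CommRing R] (v : Fin 10 → R) (i j : Fin 3)
    (hij : i ≠ j) (t : R) : salmonT (cubicAct v (Matrix.transvection i j t)) = salmonT v := by
  fin_cases i <;> fin_cases j <;> first | exact absurd rfl hij | skip
  all_goals
    simp [salmonT, cubicAct, polarForm, Matrix.transvection, Matrix.single]
    ring

/-- The Aronhold invariants are invariants of weight `4` and `6`. -/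
theorem salmon_cubicAct {K : Type*} [Field K] [CharZero K] (g : Matrix (Fin 3) (Fin 3) K) :
    ∀ v : Fin 10 → K, salmonS (cubicAct v g) = g.det ^ 4 * salmonS v ∧
      salmonT (cubicAct v g) = g.det ^ 6 * salmonT v := by
  -- Every matrix over a field, singular ones included, is a product of transvections and a diagonal
  -- matrix, so only polynomial identities for these factors are needed.
  refine Matrix.diagonal_transvection_induction (fun g => ∀ v : Fin 10 → K,
    salmonS (cubicAct v g) = g.det ^ 4 * salmonS v ∧
      salmonT (cubicAct v g) = g.det ^ 6 * salmonT v) g ?_ ?_ ?_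
  · intro D _ v
    exact ⟨salmonS_cubicAct_diagonal v D, salmonT_cubicAct_diagonal v D⟩
  · intro t v
    rw [Matrix.TransvectionStruct.det, one_pow, one_pow, one_mul, one_mul]
    exact ⟨salmonS_cubicAct_transvection v _ _ t.hij _, salmonT_cubicAct_transvection v _ _ t.hij _⟩
  · intro A B hA hB v
    rw [cubicAct_mul, (hB _).1, (hB _).2, (hA _).1, (hA _).2, Matrix.det_mul]
    exact ⟨by ring, by ring⟩

/-! ### The real null cone -/

/-- A real ternary cubic which can be sent to `0` by real matrices of determinant one. -/
def IsUnstableCubic (v : Fin 10 → ℝ) : Prop :=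
  ∀ ε > 0, ∃ g : Matrix (Fin 3) (Fin 3) ℝ, g.det ≠ 0 ∧ ‖cubicAct v g‖ ≤ ε * |g.det|

theorem IsUnstableCubic.of_cubicAct {v : Fin 10 → ℝ} {g : Matrix (Fin 3) (Fin 3) ℝ}
    (hg : g.det ≠ 0) (h : IsUnstableCubic (cubicAct v g)) : IsUnstableCubic v := by
  intro ε hε
  obtain ⟨φ, hφ, hle⟩ := h (ε * |g.det|) (mul_pos hε (abs_pos.mpr hg))
  refine ⟨g * φ, by rw [Matrix.det_mul]; exact mul_ne_zero hg hφ, ?_⟩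
  rw [cubicAct_mul, Matrix.det_mul, abs_mul, ← mul_assoc]
  exact hle

/-- A cubic with a singular point whose tangent cone is a double line is unstable. -/
theorem isUnstableCubic_of_double_tangent {v : Fin 10 → ℝ} (h0 : v 0 = 0) (h3 : v 3 = 0)
    (h4 : v 4 = 0) (h5 : v 5 = 0) (h9 : v 9 = 0) : IsUnstableCubic v := by
  intro ε hε
  have hv : 0 < ‖v‖ + 1 := by positivity
  set t : ℝ := min 1 (ε / (‖v‖ + 1)) with ht
  have ht0 : 0 < t := lt_min one_pos (div_pos hε hv)
  have ht1 : t ≤ 1 := min_le_left _ _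
  have htε : t * ‖v‖ ≤ ε := by
    calc t * ‖v‖ ≤ ε / (‖v‖ + 1) * (‖v‖ + 1) :=
          mul_le_mul (min_le_right _ _) (by linarith) (norm_nonneg _) (div_pos hε hv).le
      _ = ε := div_mul_cancel₀ _ hv.ne'
  -- The exponents 0, 6, 9 give the determinant order 15, while the surviving monomials y³, z³, y²z,
  -- xz², yz² get orders 18, 27, 21, 18, 24. The slack of at least one power of t absorbs ‖v‖.
  have hdet : (Matrix.diagonal ![1, t ^ 6, t ^ 9]).det = t ^ 15 := by
    simp [Matrix.det_diagonal, Fin.prod_univ_three]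
    ring
  refine ⟨Matrix.diagonal ![1, t ^ 6, t ^ 9], by rw [hdet]; positivity, ?_⟩
  rw [hdet, abs_of_pos (by positivity)]
  have key : ∀ (i : Fin 10) (k : ℕ), 18 ≤ k → |v i| * |t| ^ k ≤ ε * t ^ 15 := by
    intro i k hk
    rw [abs_of_pos ht0, mul_comm]
    calc t ^ k * |v i| ≤ t ^ 16 * ‖v‖ :=
          mul_le_mul (pow_le_pow_of_le_one ht0.le ht1 (by omega)) (norm_le_pi_norm v i)
            (abs_nonneg _) (by positivity)
      _ = (t * ‖v‖) * t ^ 15 := by ring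
      _ ≤ ε * t ^ 15 := by gcongr
  rw [pi_norm_le_iff_of_nonneg (by positivity)]
  have hpos : 0 ≤ ε * t ^ 15 := by positivity
  intro i
  rw [Real.norm_eq_abs]
  fin_cases i <;> simp [cubicAct, polarForm, h0, h3, h4, h5, h9, hpos]
  · convert key 1 18 (by norm_num) using 2; ring
  · convert key 2 27 (by norm_num) using 2; ring
  · convert key 6 21 (by norm_num) using 2; ring
  · convert key 7 18 (by norm_num) using 2; ring
  · convert key 8 24 (by norm_num) using 2; ring

/-- A monic cubic polynomial with vanishing discriminant has a double root. -/
theorem exists_double_root {p q r : ℝ}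
    (h : p ^ 2 * q ^ 2 - 4 * q ^ 3 - 4 * p ^ 3 * r - 27 * r ^ 2 + 18 * p * q * r = 0) :
    ∃ t : ℝ, t ^ 3 + p * t ^ 2 + q * t + r = 0 ∧ 3 * t ^ 2 + 2 * p * t + q = 0 := by
  by_cases hpq : p ^ 2 - 3 * q = 0
  · have hq : q = p ^ 2 / 3 := by linarith
    subst hq
    have hr : (r - p ^ 3 / 27) ^ 2 = 0 := by linear_combination (-1 / 27) * h
    have hr' : r = p ^ 3 / 27 := by linarith [pow_eq_zero_iff (two_ne_zero) |>.mp hr]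
    exact ⟨-p / 3, by rw [hr']; ring, by ring⟩
  -- Dividing the cubic by its derivative leaves a linear remainder, whose root is this quotient.
  -- Zero discriminant makes it a root of the derivative, hence of the cubic.
  · have hs : 3 * ((9 * r - p * q) / (2 * (p ^ 2 - 3 * q))) ^ 2
        + 2 * p * ((9 * r - p * q) / (2 * (p ^ 2 - 3 * q))) + q = 0 := by
      field_simp
      linear_combination (-9) * h
    refine ⟨_, ?_, hs⟩
    set t := (9 * r - p * q) / (2 * (p ^ 2 - 3 * q)) with ht
    have ht' : t * (2 * (p ^ 2 - 3 * q)) = 9 * r - p * q := by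
      exact div_mul_cancel₀ _ (mul_ne_zero two_ne_zero hpq)
    linear_combination (t / 3 + p / 9) * hs - ht' / 9

/-! ### Case analysis at a real point of the cubic curve -/

theorem salmonS_cubicAct_eq_zero {v : Fin 10 → ℝ} (g : Matrix (Fin 3) (Fin 3) ℝ) (h : salmonS v = 0) :
    salmonS (cubicAct v g) = 0 := by
  rw [(salmon_cubicAct g v).1, h, mul_zero]

theorem salmonT_cubicAct_eq_zero {v : Fin 10 → ℝ} (g : Matrix (Fin 3) (Fin 3) ℝ) (h : salmonT v = 0) :
    salmonT (cubicAct v g) = 0 := by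
  rw [(salmon_cubicAct g v).2, h, mul_zero]

/-- The point (0,0,1) is singular with tangent cone v₄x² + 2v₉xy + v₆y², and S is minus the square
of the discriminant v₉² - v₄v₆. So S = 0 makes the cone a double line (or zero), and its kernel
direction is taken as the second basis vector. -/
theorem isUnstableCubic_of_singular {v : Fin 10 → ℝ} (h2 : v 2 = 0) (h7 : v 7 = 0) (h8 : v 8 = 0)
    (hS : salmonS v = 0) : IsUnstableCubic v := by
  have hdisc : v 9 ^ 2 = v 4 * v 6 := by
    have : (v 9 ^ 2 - v 4 * v 6) ^ 2 = 0 := by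
      simp only [salmonS, h2, h7, h8] at hS
      linear_combination -hS
    linarith [pow_eq_zero_iff (two_ne_zero) |>.mp this]
  by_cases h4 : v 4 = 0
  · have h9 : v 9 = 0 := by simpa [h4] using hdisc
    refine IsUnstableCubic.of_cubicAct (g := !![0, 1, 0; 0, 0, 1; 1, 0, 0])
      (by simp [Matrix.det_fin_three])
      (isUnstableCubic_of_double_tangent ?_ ?_ ?_ ?_ ?_) <;>
    simp [cubicAct, polarForm, h2, h7, h8, h4, h9]
  · refine IsUnstableCubic.of_cubicAct (g := !![0, -(v 9 / v 4), 1; 0, 1, 0; 1, 0, 0])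
      (by simp [Matrix.det_fin_three])
      (isUnstableCubic_of_double_tangent ?_ ?_ ?_ ?_ ?_) <;>
    simp [cubicAct, polarForm, h2, h7, h8]
    · field_simp
      linear_combination -hdisc
    · field_simp
      ring

/-- This is a Weierstrass form 3v₇xz² + f(x,y). The invariants give v₁v₃ = v₅² and v₁²v₀ = v₅³. If
v₁ ≠ 0, then f is a multiple of the cube of v₁y + v₅x and the curve has a cusp; if v₁ = 0, the line
x = 0 splits off and the singular point is (0,1,0). -/
theorem isUnstableCubic_of_flex {v : Fin 10 → ℝ} (h2 : v 2 = 0) (h8 : v 8 = 0) (h4 : v 4 = 0)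
    (h9 : v 9 = 0) (h6 : v 6 = 0) (h7 : v 7 ≠ 0) (hS : salmonS v = 0) (hT : salmonT v = 0) :
    IsUnstableCubic v := by
  simp only [salmonS, salmonT, h2, h8, h4, h9, h6] at hS hT
  have hS' : v 1 * v 3 = v 5 ^ 2 :=
    mul_left_cancel₀ (pow_ne_zero 2 h7) (by linear_combination hS)
  have hT' : v 1 ^ 2 * v 0 = v 5 ^ 3 :=
    mul_left_cancel₀ (pow_ne_zero 3 h7)
      (by linear_combination hT / 4 + 3 * v 5 * v 7 ^ 3 * hS')
  by_cases h1 : v 1 = 0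
  · have h5 : v 5 = 0 := by simpa [h1] using hS'.symm
    refine IsUnstableCubic.of_cubicAct (g := !![0, 0, 1; 1, 0, 0; 0, 1, 0])
      (by simp [Matrix.det_fin_three])
      (isUnstableCubic_of_double_tangent ?_ ?_ ?_ ?_ ?_) <;>
    simp [cubicAct, polarForm, h2, h8, h4, h9, h6, h1, h5]
  · have h3 : v 3 = v 5 ^ 2 / v 1 := by rw [← hS']; field_simp
    have h0 : v 0 = v 5 ^ 3 / v 1 ^ 2 := by rw [← hT']; field_simp
    refine IsUnstableCubic.of_cubicAct (g := !![1, 0, 0; -(v 5 / v 1), 1, 0; 0, 0, 1])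
      (by simp [Matrix.det_fin_three])
      (isUnstableCubic_of_double_tangent ?_ ?_ ?_ ?_ ?_) <;>
    simp [cubicAct, polarForm, h2, h8, h4, h9, h6, h3, h0]
    all_goals
      field_simp
      try ring

theorem isUnstableCubic_of_normalized_not_flex {v : Fin 10 → ℝ} (h2 : v 2 = 0) (h8 : v 8 = 0)
    (h4 : v 4 = 0) (h9 : v 9 = 0) (h6 : v 6 = 1) (h7 : v 7 = 1) (hS : salmonS v = 0)
    (hT : salmonT v = 0) : IsUnstableCubic v := by
  simp only [salmonS, salmonT, h2, h8, h4, h9, h6, h7] at hS hT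
  have h0 : v 0 = v 5 ^ 2 - v 1 * v 3 := by linear_combination hS
  rw [h0] at hT
  -- On the conic where the z-derivative vanishes, parametrized by (1, -t, -t²/2), the y-derivative
  -- is three times t³ + v₁t² - 2v₅t + v₃. After eliminating v₀ by S = 0, T is the discriminant of
  -- this polynomial. A root gives a singular point; it being double makes the tangent cone the
  -- double line spanned by (0,1,t).
  obtain ⟨t, ht, ht'⟩ := exists_double_root (p := v 1) (q := -2 * v 5) (r := v 3)
    (by linear_combination hT)
  have h5 : v 5 = (3 * t ^ 2 + 2 * v 1 * t) / 2 := by linarith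
  have h3 : v 3 = 2 * v 5 * t - t ^ 3 - v 1 * t ^ 2 := by linarith
  refine IsUnstableCubic.of_cubicAct (g := !![1, 0, 0; -t, 1, 0; -(t ^ 2 / 2), t, 1])
    (by simp [Matrix.det_fin_three])
    (isUnstableCubic_of_double_tangent ?_ ?_ ?_ ?_ ?_) <;>
  simp [cubicAct, polarForm, h2, h8, h4, h9, h6, h7] <;>
  (try rw [h0]) <;> (try rw [h3]) <;> (try rw [h5]) <;> ring

theorem isUnstableCubic_of_not_flex {v : Fin 10 → ℝ} (h2 : v 2 = 0) (h8 : v 8 = 0)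
    (h4 : v 4 = 0) (h9 : v 9 = 0) (h6 : v 6 ≠ 0) (h7 : v 7 ≠ 0) (hS : salmonS v = 0)
    (hT : salmonT v = 0) : IsUnstableCubic v := by
  set g : Matrix (Fin 3) (Fin 3) ℝ := Matrix.diagonal ![v 6 ^ 2 / v 7, 1, (v 6)⁻¹] with hg
  have hdet : g.det ≠ 0 := by
    rw [hg, Matrix.det_diagonal, Fin.prod_univ_three]
    simp [h6, h7]
  refine IsUnstableCubic.of_cubicAct hdet (isUnstableCubic_of_normalized_not_flex ?_ ?_ ?_ ?_ ?_ ?_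
    (salmonS_cubicAct_eq_zero g hS) (salmonT_cubicAct_eq_zero g hT)) <;>
  simp [hg, cubicAct, polarForm, h2, h8, h4, h9, h6]
  field_simp

/-- The tangent line at (0,0,1) is x = 0. Completing the square in z removes the terms x²z and xyz;
the remaining coefficient of y²z vanishes exactly when the point is a flex. -/
theorem isUnstableCubic_of_smooth_point {v : Fin 10 → ℝ} (h2 : v 2 = 0) (h8 : v 8 = 0)
    (h7 : v 7 ≠ 0) (hS : salmonS v = 0) (hT : salmonT v = 0) : IsUnstableCubic v := by
  set g : Matrix (Fin 3) (Fin 3) ℝ :=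
    !![1, 0, 0; 0, 1, 0; -(v 4 / (2 * v 7)), -(v 9 / v 7), 1] with hg
  have hdet : g.det ≠ 0 := by simp [hg, Matrix.det_fin_three]
  have e2 : cubicAct v g 2 = 0 := by simp [hg, cubicAct, polarForm, h2]
  have e8 : cubicAct v g 8 = 0 := by simp [hg, cubicAct, polarForm, h2, h8]
  have e4 : cubicAct v g 4 = 0 := by
    simp [hg, cubicAct, polarForm, h2, h8]
    field_simp
    ring
  have e9 : cubicAct v g 9 = 0 := by
    simp [hg, cubicAct, polarForm, h2, h8]
    field_simp
    ring
  have e7 : cubicAct v g 7 ≠ 0 := by simpa [hg, cubicAct, polarForm, h2] using h7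
  have eS := salmonS_cubicAct_eq_zero g hS
  have eT := salmonT_cubicAct_eq_zero g hT
  refine IsUnstableCubic.of_cubicAct hdet ?_
  by_cases e6 : cubicAct v g 6 = 0
  · exact isUnstableCubic_of_flex e2 e8 e4 e9 e6 e7 eS eT
  · exact isUnstableCubic_of_not_flex e2 e8 e4 e9 e6 e7 eS eT

theorem isUnstableCubic_of_real_point {v : Fin 10 → ℝ} (h2 : v 2 = 0) (hS : salmonS v = 0)
    (hT : salmonT v = 0) : IsUnstableCubic v := by
  by_cases h7 : v 7 = 0
  · by_cases h8 : v 8 = 0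
    · exact isUnstableCubic_of_singular h2 h7 h8 hS
    · set g : Matrix (Fin 3) (Fin 3) ℝ := !![0, 1, 0; 1, 0, 0; 0, 0, 1] with hg
      refine IsUnstableCubic.of_cubicAct (g := g) (by simp [hg, Matrix.det_fin_three])
        (isUnstableCubic_of_smooth_point ?_ ?_ ?_
          (salmonS_cubicAct_eq_zero g hS) (salmonT_cubicAct_eq_zero g hT)) <;>
      simp [hg, cubicAct, polarForm, h2, h7, h8]
  · set g : Matrix (Fin 3) (Fin 3) ℝ := !![1, -(v 8 / v 7), 0; 0, 1, 0; 0, 0, 1] with hg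
    refine IsUnstableCubic.of_cubicAct (g := g) (by simp [hg, Matrix.det_fin_three])
      (isUnstableCubic_of_smooth_point ?_ ?_ ?_
        (salmonS_cubicAct_eq_zero g hS) (salmonT_cubicAct_eq_zero g hT)) <;>
    simp [hg, cubicAct, polarForm, h2, h7]
    field_simp
    ring

/-- A real ternary cubic whose Aronhold invariants vanish is unstable over the reals. -/
theorem isUnstableCubic_of_invariants_eq_zero {v : Fin 10 → ℝ} (hS : salmonS v = 0)
    (hT : salmonT v = 0) : IsUnstableCubic v := by
  -- f θ is the value of the cubic at (0, -sin θ, cos θ). A half turn changes its sign because the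
  -- degree is odd, so it vanishes somewhere.
  set f : ℝ → ℝ := fun θ => cubicAct v
    !![1, 0, 0; 0, Real.cos θ, -Real.sin θ; 0, Real.sin θ, Real.cos θ] 2 with hf
  have hcont : Continuous f := by
    simp only [hf, cubicAct, polarForm]
    simp
    fun_prop
  have hπ : f Real.pi = - f 0 := by
    simp [hf, cubicAct, polarForm]
  obtain ⟨θ, hθ⟩ : ∃ θ, f θ = 0 := by
    apply mem_range_of_exists_le_of_exists_ge hcont
    · rcases le_total (f 0) 0 with h | h
      · exact ⟨0, h⟩
      · exact ⟨Real.pi, by linarith⟩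
    · rcases le_total (f 0) 0 with h | h
      · exact ⟨Real.pi, by linarith⟩
      · exact ⟨0, h⟩
  set g : Matrix (Fin 3) (Fin 3) ℝ :=
    !![1, 0, 0; 0, Real.cos θ, -Real.sin θ; 0, Real.sin θ, Real.cos θ] with hg
  have hdet : g.det = 1 := by
    simp [hg, Matrix.det_fin_three]
    nlinarith [Real.sin_sq_add_cos_sq θ]
  exact IsUnstableCubic.of_cubicAct (by rw [hdet]; exact one_ne_zero)
    (isUnstableCubic_of_real_point hθ (salmonS_cubicAct_eq_zero g hS) (salmonT_cubicAct_eq_zero g hT))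

/-! ### Normalization of the determinant -/

theorem cubicAct_smul_matrix {R : Type*} [CommRing R] (v : Fin 10 → R) (c : R)
    (g : Matrix (Fin 3) (Fin 3) R) : cubicAct v (c • g) = c ^ 3 • cubicAct v g := by
  have key : ∀ u w s : Fin 3 → R, polarForm v (fun i => c * u i) (fun i => c * w i)
      (fun i => c * s i) = c ^ 3 * polarForm v u w s := by
    intro u w s
    simp only [polarForm]
    ring
  simp only [cubicAct, Matrix.smul_apply, smul_eq_mul, key, Matrix.smul_cons, Matrix.smul_empty]

theorem exists_cube_root (d : ℝ) : ∃ c : ℝ, c ^ 3 = d := by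
  have key : ∀ e : ℝ, 0 ≤ e → (e ^ (1 / 3 : ℝ)) ^ 3 = e := by
    intro e he
    rw [← Real.rpow_natCast, ← Real.rpow_mul he]
    norm_num
  rcases le_total 0 d with h | h
  · exact ⟨_, key d h⟩
  · exact ⟨-(-d) ^ (1 / 3 : ℝ), by rw [Odd.neg_pow (by decide), key (-d) (by linarith), neg_neg]⟩

/-- Degree and dimension are both 3, so scaling g by c multiplies both the form and the determinant
by c³; the ratio in `IsUnstableCubic` is scale-free. -/
theorem IsUnstableCubic.exists_det_one {v : Fin 10 → ℝ} (h : IsUnstableCubic v) {ε : ℝ}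
    (hε : 0 < ε) : ∃ g : Matrix (Fin 3) (Fin 3) ℝ, g.det = 1 ∧ ‖cubicAct v g‖ ≤ ε := by
  obtain ⟨g, hg, hle⟩ := h ε hε
  obtain ⟨c, hc⟩ := exists_cube_root g.det⁻¹
  refine ⟨c • g, ?_, ?_⟩
  · rw [Matrix.det_smul, Fintype.card_fin, hc, inv_mul_cancel₀ hg]
  · rw [cubicAct_smul_matrix, hc, norm_smul, norm_inv, Real.norm_eq_abs, inv_mul_le_iff₀
      (abs_pos.mpr hg), mul_comm]
    exact hle

/-! ### Compatibility -/

theorem continuous_salmonS {K : Type*} [CommRing K] [TopologicalSpace K] [IsTopologicalRing K] :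
    Continuous (salmonS : (Fin 10 → K) → K) := by
  unfold salmonS
  fun_prop

theorem continuous_salmonT {K : Type*} [CommRing K] [TopologicalSpace K] [IsTopologicalRing K] :
    Continuous (salmonT : (Fin 10 → K) → K) := by
  unfold salmonT
  fun_prop

theorem salmonS_ofReal (v : Fin 10 → ℝ) :
    salmonS (fun i => (v i : ℂ)) = ((salmonS v : ℝ) : ℂ) := by
  simp [salmonS]

theorem salmonT_ofReal (v : Fin 10 → ℝ) :
    salmonT (fun i => (v i : ℂ)) = ((salmonT v : ℝ) : ℂ) := by
  simp [salmonT]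

theorem map_ternaryCubic {R S : Type*} [CommRing R] [CommRing S] (f : R →+* S) (v : Fin 10 → R) :
    MvPolynomial.map f (ternaryCubic v) = ternaryCubic (fun i => f (v i)) := by
  simp [ternaryCubic]

theorem tendsto_coeff_ternaryCubic {K : Type*} [CommRing K] [TopologicalSpace K]
    [IsTopologicalRing K] {w : ℕ → Fin 10 → K} (hw : Tendsto w atTop (𝓝 0)) :
    TendstoZeroCoeff (fun n => ternaryCubic (w n)) := by
  intro s
  rw [ternaryExp_eq s]
  generalize s 0 = i
  generalize s 1 = j
  generalize s 2 = k
  have hcont : Continuous fun v : Fin 10 → K => (ternaryCubic v).coeff (ternaryExp i j k) := by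
    simp only [coeff_ternaryCubic]
    repeat refine Continuous.add ?_ ?_
    all_goals
      split_ifs <;> fun_prop
  have h0 : (ternaryCubic (0 : Fin 10 → K)).coeff (ternaryExp i j k) = 0 := by
    simp [coeff_ternaryCubic]
  have := (hcont.tendsto 0).comp hw
  rwa [h0] at this

theorem tendsto_zero_of_tendsto_coeff {K : Type*} [Field K] [CharZero K] [TopologicalSpace K]
    [IsTopologicalRing K] {w : ℕ → Fin 10 → K}
    (hw : TendstoZeroCoeff (fun n => ternaryCubic (w n))) : Tendsto w atTop (𝓝 0) := by
  rw [show w = fun n => normCoeffs (ternaryCubic (w n)) from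
    funext fun n => (normCoeffs_ternaryCubic _).symm]
  have key : ∀ (s : Fin 3 →₀ ℕ) (r : K),
      Tendsto (fun n => (ternaryCubic (w n)).coeff s / r) atTop (𝓝 0) := by
    intro s r
    simpa [div_eq_mul_inv] using (hw s).mul_const r⁻¹
  have h0 : (0 : Fin 10 → K) = ![0, 0, 0, 0, 0, 0, 0, 0, 0, 0] := by
    ext i
    fin_cases i <;> rfl
  rw [h0]
  unfold normCoeffs
  iterate 3 refine Filter.Tendsto.matrixVecCons (hw _) ?_
  iterate 7 refine Filter.Tendsto.matrixVecCons (key _ _) ?_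
  exact tendsto_const_nhds

/-- S and T are constant along a complex unimodular sequence and continuous, so they vanish when it
tends to 0. The real null cone theorem then provides real matrices. -/
theorem isCompatiblePair_three_three : IsCompatiblePair 3 3 := by
  rintro π hπ ⟨φ, hφ, hlim⟩
  set v := normCoeffs π with hv
  have hπv : π = ternaryCubic v := (ternaryCubic_normCoeffs hπ).symm
  rw [hπv] at hlim ⊢
  rw [map_ternaryCubic] at hlim
  simp only [compMatrix_ternaryCubic] at hlim ⊢
  have hw := tendsto_zero_of_tendsto_coeff hlim
  have hS : salmonS v = 0 := by
    have h1 := (continuous_salmonS.tendsto _).comp hw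
    have h2 : salmonS (0 : Fin 10 → ℂ) = 0 := by simp [salmonS]
    have h3 : (salmonS ∘ fun n => cubicAct (fun i => (algebraMap ℝ ℂ) (v i)) (φ n))
        = fun _ => ((salmonS v : ℝ) : ℂ) := by
      funext n
      rw [Function.comp_apply, (salmon_cubicAct _ _).1, hφ, one_pow, one_mul]
      exact salmonS_ofReal v
    rw [h2, h3, tendsto_const_nhds_iff] at h1
    exact_mod_cast h1
  have hT : salmonT v = 0 := by
    have h1 := (continuous_salmonT.tendsto _).comp hw
    have h2 : salmonT (0 : Fin 10 → ℂ) = 0 := by simp [salmonT]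
    have h3 : (salmonT ∘ fun n => cubicAct (fun i => (algebraMap ℝ ℂ) (v i)) (φ n))
        = fun _ => ((salmonT v : ℝ) : ℂ) := by
      funext n
      rw [Function.comp_apply, (salmon_cubicAct _ _).2, hφ, one_pow, one_mul]
      exact salmonT_ofReal v
    rw [h2, h3, tendsto_const_nhds_iff] at h1
    exact_mod_cast h1
  have hunst := isUnstableCubic_of_invariants_eq_zero hS hT
  choose ψ hψ hψle using fun n : ℕ => hunst.exists_det_one (Nat.one_div_pos_of_nat (α := ℝ) (n := n))
  exact ⟨ψ, hψ, tendsto_coeff_ternaryCubic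
    (squeeze_zero_norm hψle tendsto_one_div_add_atTop_nhds_zero_nat)⟩

/-! ### Near-minimal representatives of an orbit -/

/-- The combination `|S| ^ 3 + T ^ 2` of the Aronhold invariants. -/
def aronholdHeight (v : Fin 10 → ℝ) : ℝ := |salmonS v| ^ 3 + salmonT v ^ 2

theorem aronholdHeight_nonneg (v : Fin 10 → ℝ) : 0 ≤ aronholdHeight v := by
  unfold aronholdHeight
  positivity

theorem continuous_aronholdHeight : Continuous aronholdHeight :=
  (continuous_salmonS.abs.pow 3).add (continuous_salmonT.pow 2)

theorem aronholdHeight_cubicAct (v : Fin 10 → ℝ) (g : Matrix (Fin 3) (Fin 3) ℝ) :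
    aronholdHeight (cubicAct v g) = |g.det| ^ 12 * aronholdHeight v := by
  rw [aronholdHeight, (salmon_cubicAct g v).1, (salmon_cubicAct g v).2, aronholdHeight, abs_mul,
    abs_pow, ← sq_abs (_ * _), abs_mul, abs_pow, ← sq_abs (salmonT v)]
  ring

theorem aronholdHeight_smul (c : ℝ) (v : Fin 10 → ℝ) :
    aronholdHeight (c • v) = |c| ^ 12 * aronholdHeight v := by
  have h1 : salmonS (c • v) = c ^ 4 * salmonS v := by
    simp only [salmonS, Pi.smul_apply, smul_eq_mul]
    ring
  have h2 : salmonT (c • v) = c ^ 6 * salmonT v := by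
    simp only [salmonT, Pi.smul_apply, smul_eq_mul]
    ring
  rw [aronholdHeight, h1, h2, aronholdHeight, abs_mul,
    abs_pow, ← sq_abs (_ * _), abs_mul, abs_pow, ← sq_abs (salmonT v)]
  ring

theorem cubicAct_smul {R : Type*} [CommRing R] (c : R) (v : Fin 10 → R)
    (g : Matrix (Fin 3) (Fin 3) R) : cubicAct (c • v) g = c • cubicAct v g := by
  have key : ∀ u w s : Fin 3 → R, polarForm (c • v) u w s = c * polarForm v u w s := by
    intro u w s
    simp only [polarForm, Pi.smul_apply, smul_eq_mul]
    ring
  simp only [cubicAct, smul_eq_mul, key, Matrix.smul_cons, Matrix.smul_empty]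

theorem continuous_cubicAct {K : Type*} [CommRing K] [TopologicalSpace K] [IsTopologicalRing K]
    (g : Matrix (Fin 3) (Fin 3) K) : Continuous fun v : Fin 10 → K => cubicAct v g := by
  have key : ∀ u w s : Fin 3 → K, Continuous fun v : Fin 10 → K => polarForm v u w s := by
    intro u w s
    unfold polarForm
    fun_prop
  unfold cubicAct
  iterate 10 refine Continuous.matrixVecCons (key _ _ _) ?_
  exact continuous_const

theorem exists_aronholdHeight_le : ∃ M : ℝ, 0 < M ∧
    ∀ v : Fin 10 → ℝ, aronholdHeight v ≤ M * ‖v‖ ^ 12 := by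
  obtain ⟨M, hM⟩ := (isCompact_sphere (0 : Fin 10 → ℝ) 1).bddAbove_image
    continuous_aronholdHeight.continuousOn
  refine ⟨max M 1, by positivity, fun v => ?_⟩
  by_cases hv : v = 0
  · simp [hv, aronholdHeight, salmonS, salmonT]
  · have hn : 0 < ‖v‖ := norm_pos_iff.mpr hv
    have h1 : aronholdHeight (‖v‖⁻¹ • v) ≤ M :=
      hM ⟨_, by simp [norm_smul, hn.ne'], rfl⟩
    rw [aronholdHeight_smul, abs_inv, abs_norm, inv_pow, inv_mul_le_iff₀ (by positivity)] at h1
    calc aronholdHeight v ≤ ‖v‖ ^ 12 * M := h1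
      _ ≤ max M 1 * ‖v‖ ^ 12 := by
        rw [mul_comm]
        gcongr
        exact le_max_left _ _

/-- The condition is closed, being an intersection over g of closed conditions, so the height
attains its minimum on a compact set. A zero there would be an unstable form, which some unimodular
g brings below 1/2. -/
theorem exists_aronholdHeight_ge_of_almost_minimal : ∃ δ : ℝ, 0 < δ ∧ ∀ v : Fin 10 → ℝ, ‖v‖ = 1 →
    (∀ g : Matrix (Fin 3) (Fin 3) ℝ, g.det = 1 → 1 / 2 ≤ ‖cubicAct v g‖) →
      δ ≤ aronholdHeight v := by
  set F : Set (Fin 10 → ℝ) := Metric.sphere 0 1 ∩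
    ⋂ (g : Matrix (Fin 3) (Fin 3) ℝ) (_ : g.det = 1), {v | 1 / 2 ≤ ‖cubicAct v g‖} with hF
  have hcomp : IsCompact F := by
    refine (isCompact_sphere _ _).inter_right (isClosed_iInter fun g => isClosed_iInter fun _ => ?_)
    exact isClosed_le continuous_const (continuous_cubicAct g).norm
  have hmem : ∀ v, v ∈ F ↔ ‖v‖ = 1 ∧
      ∀ g : Matrix (Fin 3) (Fin 3) ℝ, g.det = 1 → 1 / 2 ≤ ‖cubicAct v g‖ := by
    intro v
    simp [hF]
  rcases F.eq_empty_or_nonempty with hE | hne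
  · exact ⟨1, one_pos, fun v h1 h2 => absurd ((hmem v).mpr ⟨h1, h2⟩) (by simp [hE])⟩
  · obtain ⟨w, hw, hmin⟩ := hcomp.exists_isMinOn hne continuous_aronholdHeight.continuousOn
    refine ⟨aronholdHeight w, ?_, fun v h1 h2 => hmin ((hmem v).mpr ⟨h1, h2⟩)⟩
    refine lt_of_le_of_ne (aronholdHeight_nonneg w) fun h0 => ?_
    have hS : |salmonS w| ^ 3 = 0 := by
      have := pow_nonneg (abs_nonneg (salmonS w)) 3
      have := sq_nonneg (salmonT w)
      unfold aronholdHeight at h0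
      linarith
    have hT : salmonT w ^ 2 = 0 := by
      unfold aronholdHeight at h0
      linarith
    rw [pow_eq_zero_iff (by norm_num), abs_eq_zero] at hS
    rw [pow_eq_zero_iff (by norm_num)] at hT
    obtain ⟨g, hg, hle⟩ := (isUnstableCubic_of_invariants_eq_zero hS hT).exists_det_one
      (ε := 1 / 4) (by norm_num)
    have := ((hmem w).mp hw).2 g hg
    linarith

theorem exists_cubicAct_norm_le : ∃ δ : ℝ, 0 < δ ∧ ∀ (v : Fin 10 → ℝ) (ε : ℝ), 0 < ε →
    ∃ g : Matrix (Fin 3) (Fin 3) ℝ, g.det = 1 ∧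
      (‖cubicAct v g‖ < ε ∨ δ * ‖cubicAct v g‖ ^ 12 ≤ aronholdHeight v) := by
  obtain ⟨δ, hδ, hmain⟩ := exists_aronholdHeight_ge_of_almost_minimal
  refine ⟨δ, hδ, fun v ε hε => ?_⟩
  by_cases hex : ∃ g : Matrix (Fin 3) (Fin 3) ℝ, g.det = 1 ∧ ‖cubicAct v g‖ < ε
  · obtain ⟨g, hg, hlt⟩ := hex
    exact ⟨g, hg, Or.inl hlt⟩
  push Not at hex
  set A : Set ℝ := {r | ∃ g : Matrix (Fin 3) (Fin 3) ℝ, g.det = 1 ∧ r = ‖cubicAct v g‖} with hA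
  have hAne : A.Nonempty := ⟨_, 1, Matrix.det_one, rfl⟩
  have hAlow : ε ≤ sInf A := le_csInf hAne (by rintro _ ⟨g, hg, rfl⟩; exact hex g hg)
  have hAbdd : BddBelow A := ⟨0, by rintro _ ⟨g, -, rfl⟩; exact norm_nonneg _⟩
  -- The infimum is at least ε > 0, hence less than its double. An orbit element within factor 2 of
  -- it, once normalized, has all its translates of norm at least 1/2.
  obtain ⟨_, ⟨g, hg, rfl⟩, hlt⟩ := exists_lt_of_csInf_lt hAne
    (show sInf A < 2 * sInf A by linarith)
  refine ⟨g, hg, Or.inr ?_⟩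
  have hP : 0 < ‖cubicAct v g‖ := hε.trans_le (hex g hg)
  have hδle := hmain (‖cubicAct v g‖⁻¹ • cubicAct v g) (by rw [norm_smul, norm_inv, norm_norm,
    inv_mul_cancel₀ hP.ne']) (by
    intro φ hφ
    have hle : sInf A ≤ ‖cubicAct v (g * φ)‖ :=
      csInf_le hAbdd ⟨g * φ, by rw [Matrix.det_mul, hg, hφ, one_mul], rfl⟩
    rw [cubicAct_smul, norm_smul, norm_inv, norm_norm, ← cubicAct_mul, le_inv_mul_iff₀ hP]
    linarith)
  rw [aronholdHeight_smul, aronholdHeight_cubicAct, hg, abs_one, one_pow, one_mul, abs_inv,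
    abs_norm, inv_pow, le_inv_mul_iff₀ (by positivity)] at hδle
  linarith

/-! ### Polynomial functions and third differences -/

theorem continuous_polyFun {d : ℕ} (π : MvPolynomial (Fin d) ℝ) : Continuous (polyFun π) := by
  unfold polyFun
  exact (MvPolynomial.continuous_eval π).comp (PiLp.continuous_ofLp 2 _)

theorem polyFun_compMatrix {d : ℕ} (π : MvPolynomial (Fin d) ℝ) (g : Matrix (Fin d) (Fin d) ℝ)
    (z : EuclideanSpace ℝ (Fin d)) :
    polyFun (compMatrix π g) z = polyFun π (Matrix.toEuclideanLin g z) := by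
  unfold polyFun compMatrix
  rw [← MvPolynomial.coe_aeval_eq_eval, ← MvPolynomial.coe_aeval_eq_eval]
  simp only [RingHom.coe_coe]
  rw [MvPolynomial.aeval_bind₁]
  congr 2
  funext i
  simp [Matrix.mulVec, dotProduct]

theorem totalDegree_compMatrix_le {R : Type*} [CommRing R] {d : ℕ} (π : MvPolynomial (Fin d) R)
    (g : Matrix (Fin d) (Fin d) R) : (compMatrix π g).totalDegree ≤ π.totalDegree := by
  have hlin : ∀ i, (∑ j, MvPolynomial.C (g i j) * MvPolynomial.X j :
      MvPolynomial (Fin d) R).totalDegree ≤ 1 := by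
    intro i
    refine MvPolynomial.totalDegree_finsetSum_le fun j _ => ?_
    rw [MvPolynomial.C_mul_X_eq_monomial]
    refine (MvPolynomial.totalDegree_monomial_le _ _).trans ?_
    simp
  unfold compMatrix
  rw [MvPolynomial.bind₁, MvPolynomial.aeval_def, MvPolynomial.eval₂_eq']
  refine MvPolynomial.totalDegree_finsetSum_le fun s hs => ?_
  refine (MvPolynomial.totalDegree_mul _ _).trans ?_
  rw [MvPolynomial.algebraMap_eq, MvPolynomial.totalDegree_C, zero_add]
  refine (MvPolynomial.totalDegree_finsetProd _ _).trans ?_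
  refine le_trans ?_ (MvPolynomial.le_totalDegree hs)
  rw [Finsupp.sum_fintype _ _ (fun _ => rfl)]
  refine Finset.sum_le_sum fun i _ => (MvPolynomial.totalDegree_pow _ _).trans ?_
  calc s i * _ ≤ s i * 1 := Nat.mul_le_mul_left _ (hlin i)
    _ = s i := mul_one _

/-- The mixed third difference of a function along three vectors. -/
def thirdDiff {E : Type*} [AddCommGroup E] (f : E → ℝ) (p u w s : E) : ℝ :=
  f (p + u + w + s) - f (p + u + w) - f (p + u + s) - f (p + w + s)
    + f (p + u) + f (p + w) + f (p + s) - f p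

theorem polyFun_ternaryCubic (v : Fin 10 → ℝ) (z : EuclideanSpace ℝ (Fin 3)) :
    polyFun (ternaryCubic v) z = polarForm v z z z := by
  simp [polyFun, ternaryCubic, polarForm]
  ring

theorem thirdDiff_ternaryCubic (v : Fin 10 → ℝ) (p u w s : EuclideanSpace ℝ (Fin 3)) :
    thirdDiff (polyFun (ternaryCubic v)) p u w s = 6 * polarForm v u w s := by
  simp only [thirdDiff, polyFun_ternaryCubic, polarForm, PiLp.add_apply]
  ring

theorem thirdDiff_of_totalDegree_le {q : MvPolynomial (Fin 3) ℝ} (hq : q.totalDegree ≤ 2)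
    (p u w s : EuclideanSpace ℝ (Fin 3)) : thirdDiff (polyFun q) p u w s = 0 := by
  have key : ∀ e ∈ q.support, thirdDiff (fun z : EuclideanSpace ℝ (Fin 3) =>
      q.coeff e * ∏ i, z i ^ e i) p u w s = 0 := by
    intro e he
    have hdeg : e 0 + e 1 + e 2 ≤ 2 := by
      have := (MvPolynomial.le_totalDegree he).trans hq
      rwa [Finsupp.sum_fintype _ _ (fun _ => rfl), Fin.sum_univ_three] at this
    simp only [thirdDiff, Fin.prod_univ_three, PiLp.add_apply]
    generalize e 0 = i at *
    generalize e 1 = j at *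
    generalize e 2 = k at *
    have hi : i ≤ 2 := by omega
    have hj : j ≤ 2 := by omega
    have hk : k ≤ 2 := by omega
    interval_cases i <;> interval_cases j <;> interval_cases k <;> first | omega | ring
  have hfun : polyFun q = fun z : EuclideanSpace ℝ (Fin 3) =>
      ∑ e ∈ q.support, q.coeff e * ∏ i, z i ^ e i := by
    funext z
    exact MvPolynomial.eval_eq' _ _
  rw [hfun, ← Finset.sum_eq_zero key]
  simp only [thirdDiff, Finset.sum_add_distrib, Finset.sum_sub_distrib]

/-! ### Quadratic interpolation on the standard simplex -/

/-- The quadratic Lagrange interpolant of a ternary cubic at the nodes of the standard simplex. -/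
noncomputable def standardInterpolant (w : Fin 10 → ℝ) : MvPolynomial (Fin 3) ℝ :=
  (3 / 2 * w 0) • (MvPolynomial.X 0 * MvPolynomial.X 0) + (-(1 / 2) * w 0) • MvPolynomial.X 0
    + (3 / 2 * w 1) • (MvPolynomial.X 1 * MvPolynomial.X 1) + (-(1 / 2) * w 1) • MvPolynomial.X 1
    + (3 / 2 * w 2) • (MvPolynomial.X 2 * MvPolynomial.X 2) + (-(1 / 2) * w 2) • MvPolynomial.X 2
    + (3 / 2 * (w 3 + w 5)) • (MvPolynomial.X 0 * MvPolynomial.X 1)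
    + (3 / 2 * (w 4 + w 7)) • (MvPolynomial.X 0 * MvPolynomial.X 2)
    + (3 / 2 * (w 6 + w 8)) • (MvPolynomial.X 1 * MvPolynomial.X 2)

theorem totalDegree_standardInterpolant_le (w : Fin 10 → ℝ) :
    (standardInterpolant w).totalDegree ≤ 2 := by
  have h1 : ∀ i : Fin 3, (MvPolynomial.X i : MvPolynomial (Fin 3) ℝ) ∈
      MvPolynomial.restrictTotalDegree (Fin 3) ℝ 2 := by
    intro i
    rw [MvPolynomial.mem_restrictTotalDegree, MvPolynomial.totalDegree_X]
    norm_num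
  have h2 : ∀ i j : Fin 3, (MvPolynomial.X i * MvPolynomial.X j : MvPolynomial (Fin 3) ℝ) ∈
      MvPolynomial.restrictTotalDegree (Fin 3) ℝ 2 := by
    intro i j
    rw [MvPolynomial.mem_restrictTotalDegree]
    refine (MvPolynomial.totalDegree_mul _ _).trans ?_
    rw [MvPolynomial.totalDegree_X, MvPolynomial.totalDegree_X]
  rw [← MvPolynomial.mem_restrictTotalDegree]
  unfold standardInterpolant
  repeat' apply Submodule.add_mem
  all_goals
    apply Submodule.smul_mem
    first | exact h1 _ | exact h2 _ _

theorem polyFun_standardInterpolant (w : Fin 10 → ℝ) (z : EuclideanSpace ℝ (Fin 3)) :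
    polyFun (standardInterpolant w) z = w 0 * ((3 * z 0 ^ 2 - z 0) / 2)
      + w 1 * ((3 * z 1 ^ 2 - z 1) / 2) + w 2 * ((3 * z 2 ^ 2 - z 2) / 2)
      + 3 / 2 * (w 3 + w 5) * (z 0 * z 1) + 3 / 2 * (w 4 + w 7) * (z 0 * z 2)
      + 3 / 2 * (w 6 + w 8) * (z 1 * z 2) := by
  simp [polyFun, standardInterpolant, MvPolynomial.smul_eq_C_mul]
  ring

/-- At the nodes each coordinate is 0, 1/2 or 1, so t³ = (3t² - t)/2. Two nonzero coordinates must
both be 1/2, so x²y = xy/2, and xyz = 0. -/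
theorem standardInterpolant_eq_at_node (w : Fin 10 → ℝ) (z : EuclideanSpace ℝ (Fin 3))
    {i j k : ℕ} (h : i + j + k ≤ 2) (h0 : z 0 = i / 2) (h1 : z 1 = j / 2) (h2 : z 2 = k / 2) :
    polyFun (standardInterpolant w) z = polyFun (ternaryCubic w) z := by
  rw [polyFun_standardInterpolant, polyFun_ternaryCubic, polarForm, h0, h1, h2]
  have hi : i ≤ 2 := by omega
  have hj : j ≤ 2 := by omega
  have hk : k ≤ 2 := by omega
  interval_cases i <;> interval_cases j <;> interval_cases k <;> first | omega | (push_cast; ring)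

theorem abs_sub_standardInterpolant_le (w : Fin 10 → ℝ) {z : EuclideanSpace ℝ (Fin 3)}
    (h0 : ∀ i, 0 ≤ z i) (h1 : ∀ i, z i ≤ 1) :
    |polyFun (ternaryCubic w) z - polyFun (standardInterpolant w) z| ≤ 50 * ‖w‖ := by
  have hsq : ∀ i, |z i ^ 3 - (3 * z i ^ 2 - z i) / 2| ≤ 2 := by
    intro i
    have := h0 i
    have := h1 i
    have e2 : z i ^ 2 ≤ 1 := pow_le_one₀ (h0 i) (h1 i)
    have e3 : z i ^ 3 ≤ 1 := pow_le_one₀ (h0 i) (h1 i)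
    have p2 : 0 ≤ z i ^ 2 := by positivity
    have p3 : 0 ≤ z i ^ 3 := pow_nonneg (h0 i) 3
    rw [abs_le]
    constructor <;> linarith
  have hmix : ∀ i j, |3 * (z i ^ 2 * z j) - 3 / 2 * (z i * z j)| ≤ 3 := by
    intro i j
    have e1 : z i * z j ≤ 1 := mul_le_one₀ (h1 i) (h0 j) (h1 j)
    have p1 : 0 ≤ z i * z j := mul_nonneg (h0 i) (h0 j)
    have e2 : z i ^ 2 * z j ≤ 1 := mul_le_one₀ (pow_le_one₀ (h0 i) (h1 i)) (h0 j) (h1 j)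
    have p2 : 0 ≤ z i ^ 2 * z j := mul_nonneg (by positivity) (h0 j)
    rw [abs_le]
    constructor <;> linarith
  have hxyz : |6 * (z 0 * z 1 * z 2)| ≤ 6 := by
    have e1 : z 0 * z 1 * z 2 ≤ 1 :=
      mul_le_one₀ (mul_le_one₀ (h1 0) (h0 1) (h1 1)) (h0 2) (h1 2)
    have p1 : 0 ≤ z 0 * z 1 * z 2 := mul_nonneg (mul_nonneg (h0 0) (h0 1)) (h0 2)
    rw [abs_le]
    constructor <;> linarith
  have key : ∀ (i : Fin 10) (r C : ℝ), |r| ≤ C → |w i * r| ≤ ‖w‖ * C := by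
    intro i r C hr
    rw [abs_mul]
    exact mul_le_mul (norm_le_pi_norm w i) hr (abs_nonneg _) (norm_nonneg _)
  have b0 := abs_le.mp (key 0 _ _ (hsq 0))
  have b1 := abs_le.mp (key 1 _ _ (hsq 1))
  have b2 := abs_le.mp (key 2 _ _ (hsq 2))
  have b3 := abs_le.mp (key 3 _ _ (hmix 0 1))
  have b4 := abs_le.mp (key 4 _ _ (hmix 0 2))
  have b5 := abs_le.mp (key 5 _ _ (hmix 1 0))
  have b6 := abs_le.mp (key 6 _ _ (hmix 1 2))
  have b7 := abs_le.mp (key 7 _ _ (hmix 2 0))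
  have b8 := abs_le.mp (key 8 _ _ (hmix 2 1))
  have b9 := abs_le.mp (key 9 _ _ hxyz)
  have hw := norm_nonneg w
  have hsum : polyFun (ternaryCubic w) z - polyFun (standardInterpolant w) z
      = w 0 * (z 0 ^ 3 - (3 * z 0 ^ 2 - z 0) / 2) + w 1 * (z 1 ^ 3 - (3 * z 1 ^ 2 - z 1) / 2)
      + w 2 * (z 2 ^ 3 - (3 * z 2 ^ 2 - z 2) / 2)
      + w 3 * (3 * (z 0 ^ 2 * z 1) - 3 / 2 * (z 0 * z 1))
      + w 4 * (3 * (z 0 ^ 2 * z 2) - 3 / 2 * (z 0 * z 2))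
      + w 5 * (3 * (z 1 ^ 2 * z 0) - 3 / 2 * (z 1 * z 0))
      + w 6 * (3 * (z 1 ^ 2 * z 2) - 3 / 2 * (z 1 * z 2))
      + w 7 * (3 * (z 2 ^ 2 * z 0) - 3 / 2 * (z 2 * z 0))
      + w 8 * (3 * (z 2 ^ 2 * z 1) - 3 / 2 * (z 2 * z 1))
      + w 9 * (6 * (z 0 * z 1 * z 2)) := by
    rw [polyFun_standardInterpolant, polyFun_ternaryCubic, polarForm]
    ring
  rw [hsum, abs_le]
  constructor <;> linarith [b0.1, b1.1, b2.1, b3.1, b4.1, b5.1, b6.1, b7.1, b8.1, b9.1,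
    b0.2, b1.2, b2.2, b3.2, b4.2, b5.2, b6.2, b7.2, b8.2, b9.2]

/-! ### Simplices as affine images of the standard simplex -/

/-- The vertices `0, e₀, e₁, e₂` of the standard simplex. -/
noncomputable def standardVertices : Fin 4 → EuclideanSpace ℝ (Fin 3) :=
  Fin.cons 0 fun i => EuclideanSpace.single i 1

theorem affineIndependent_standardVertices : AffineIndependent ℝ standardVertices := by
  rw [affineIndependent_iff_of_fintype]
  intro w hw hsum
  rw [Finset.weightedVSub_eq_linear_combination _ hw, Fin.sum_univ_succ] at hsum
  have hsucc : ∀ j : Fin 3, w j.succ = 0 := by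
    intro j
    have := congrArg (fun z : EuclideanSpace ℝ (Fin 3) => z j) hsum
    simpa [standardVertices, Pi.single_apply] using this
  rw [Fin.sum_univ_succ] at hw
  simp only [hsucc, Finset.sum_const_zero, add_zero] at hw
  exact fun i => Fin.cases hw hsucc i

/-- The standard simplex. -/
noncomputable def standardSimplex : Affine.Simplex ℝ (EuclideanSpace ℝ (Fin 3)) 3 :=
  ⟨standardVertices, affineIndependent_standardVertices⟩

theorem isCompact_solid {d : ℕ} (T : Affine.Simplex ℝ (EuclideanSpace ℝ (Fin d)) d) :
    IsCompact (solid T) :=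
  (Set.finite_range T.points).isCompact_convexHull ℝ

theorem nonempty_interior_solid {d : ℕ} (T : Affine.Simplex ℝ (EuclideanSpace ℝ (Fin d)) d) :
    (interior (solid T)).Nonempty := by
  rw [solid, interior_convexHull_nonempty_iff_affineSpan_eq_top,
    T.independent.affineSpan_eq_top_iff_card_eq_finrank_add_one]
  simp

theorem mem_Icc_of_mem_solid_standardSimplex {z : EuclideanSpace ℝ (Fin 3)}
    (hz : z ∈ solid standardSimplex) (i : Fin 3) : z i ∈ Set.Icc (0 : ℝ) 1 := by
  have hconv : Convex ℝ ((EuclideanSpace.proj i : EuclideanSpace ℝ (Fin 3) →L[ℝ] ℝ) ⁻¹'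
      Set.Icc (0 : ℝ) 1) :=
    (convex_Icc 0 1).linear_preimage (EuclideanSpace.proj i).toLinearMap
  refine convexHull_min ?_ hconv hz
  rintro _ ⟨j, rfl⟩
  refine Fin.cases ?_ (fun j => ?_) j
  · simp [standardSimplex, standardVertices]
  · by_cases h : i = j <;> simp [standardSimplex, standardVertices, h]

/-- The edge vectors of a simplex at its first vertex, as the columns of a matrix. -/
def edgeMatrix (T : Affine.Simplex ℝ (EuclideanSpace ℝ (Fin 3)) 3) : Matrix (Fin 3) (Fin 3) ℝ :=
  Matrix.of fun i j => (T.points j.succ - T.points 0) i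

theorem volume_solid_eq (T : Affine.Simplex ℝ (EuclideanSpace ℝ (Fin 3)) 3) :
    volume (solid T) = ENNReal.ofReal |(edgeMatrix T).det| * volume (solid standardSimplex) := by
  have himg : solid T = (fun z => T.points 0 + z) ''
      (Matrix.toEuclideanLin (edgeMatrix T) '' solid standardSimplex) := by
    rw [solid, solid, (Matrix.toEuclideanLin (edgeMatrix T)).image_convexHull, ← Set.range_comp]
    have := ((AffineEquiv.constVAdd ℝ (EuclideanSpace ℝ (Fin 3)) (T.points 0)).toAffineMap).image_convexHull
      (Set.range (Matrix.toEuclideanLin (edgeMatrix T) ∘ standardSimplex.points))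
    have h2 : (⇑((AffineEquiv.constVAdd ℝ (EuclideanSpace ℝ (Fin 3)) (T.points 0)).toAffineMap))
      = fun z => T.points 0 + z := by
      funext z
      simp
    rw [h2] at this
    rw [this, ← Set.range_comp]
    congr 2
    funext j
    refine Fin.cases ?_ (fun j => ?_) j
    · simp [standardSimplex, standardVertices]
    · ext i
      simp [standardSimplex, standardVertices, edgeMatrix]
  rw [himg, Set.image_add_left, measure_preimage_add, Measure.addHaar_image_linearMap,
    LinearMap.det_toLpLin]

theorem volume_solid_standardSimplex_pos : 0 < (volume (solid standardSimplex)).toReal :=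
  ENNReal.toReal_pos (Measure.measure_pos_of_nonempty_interior _ (nonempty_interior_solid _)).ne'
    (isCompact_solid _).measure_lt_top.ne

/-! ### Bounds for the interpolation error -/

/-- The essential supremum bounds a continuous function at every point: the set of violations inside
the interior is open and null, hence empty, and the solid lies in the closure of its interior. -/
theorem abs_le_toReal_eLpNorm_solid {d : ℕ} (T : Affine.Simplex ℝ (EuclideanSpace ℝ (Fin d)) d)
    {f : EuclideanSpace ℝ (Fin d) → ℝ} (hf : Continuous f) {z : EuclideanSpace ℝ (Fin d)}
    (hz : z ∈ solid T) : |f z| ≤ (eLpNorm f ∞ (volume.restrict (solid T))).toReal := by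
  set e := (eLpNorm f ∞ (volume.restrict (solid T))).toReal with he
  -- `toReal` sends ∞ to 0, so finiteness is needed for the real bound.
  have hfin : eLpNorm f ∞ (volume.restrict (solid T)) ≠ ∞ := by
    obtain ⟨C, hC⟩ := (isCompact_solid T).exists_bound_of_continuousOn hf.continuousOn
    rw [eLpNorm_exponent_top]
    exact (eLpNormEssSup_lt_top_of_ae_bound
      (ae_restrict_of_forall_mem (isCompact_solid T).measurableSet hC)).ne
  have hae : ∀ᵐ y ∂(volume.restrict (solid T)), |f y| ≤ e := by
    have h := ae_le_eLpNormEssSup (f := f) (μ := volume.restrict (solid T))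
    filter_upwards [h] with y hy
    rw [← eLpNorm_exponent_top] at hy
    have := ENNReal.toReal_mono hfin hy
    rwa [toReal_enorm, Real.norm_eq_abs] at this
  have hzero : volume (interior (solid T) ∩ {y | e < |f y|}) = 0 := by
    rw [ae_iff, Measure.restrict_apply₀'
      (isCompact_solid T).measurableSet.nullMeasurableSet] at hae
    refine measure_mono_null ?_ hae
    rintro y ⟨hy1, hy2⟩
    exact ⟨not_le.mpr hy2, interior_subset hy1⟩
  have hempty : interior (solid T) ∩ {y | e < |f y|} = ∅ :=
    (isOpen_interior.inter (isOpen_lt continuous_const hf.abs)).eq_empty_of_measure_zero hzero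
  have hsub : interior (solid T) ⊆ {y | |f y| ≤ e} := by
    intro y hy
    by_contra hlt
    have : y ∈ interior (solid T) ∩ {y | e < |f y|} :=
      ⟨hy, show e < |f y| from not_le.mp hlt⟩
    rw [hempty] at this
    exact this
  have hclosed : IsClosed {y | |f y| ≤ e} := isClosed_le hf.abs continuous_const
  have hcl := closure_minimal hsub hclosed
  have hconv : Convex ℝ (solid T) := convex_convexHull ℝ _
  rw [hconv.closure_interior_eq_closure_of_nonempty_interior
    (nonempty_interior_solid T)] at hcl
  exact hcl (subset_closure hz)

theorem vertex_add_edges_mem_solid (T : Affine.Simplex ℝ (EuclideanSpace ℝ (Fin 3)) 3)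
    {a : Fin 3 → ℝ} (ha : ∀ i, 0 ≤ a i) (hsum : ∑ i, a i ≤ 1) :
    T.points 0 + ∑ i : Fin 3, a i • (T.points i.succ - T.points 0) ∈ solid T := by
  refine mem_convexHull_of_exists_fintype (Fin.cons (1 - ∑ i, a i) a) T.points ?_ ?_
    (fun i => Set.mem_range_self i) ?_
  · intro i
    refine Fin.cases ?_ (fun i => ?_) i
    · simpa using hsum
    · simpa using ha i
  · simp [Fin.sum_univ_succ]
  · rw [Fin.sum_univ_succ]
    simp only [Fin.cons_zero, Fin.cons_succ, smul_sub, Finset.sum_sub_distrib, ← Finset.sum_smul]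
    module

theorem norm_cubicAct_edgeMatrix_le (T : Affine.Simplex ℝ (EuclideanSpace ℝ (Fin 3)) 3)
    (v : Fin 10 → ℝ) {q : MvPolynomial (Fin 3) ℝ} (hq : q.totalDegree ≤ 2) {e : ℝ}
    (he : ∀ z ∈ solid T, |polyFun (ternaryCubic v) z - polyFun q z| ≤ e) :
    ‖cubicAct v (edgeMatrix T)‖ ≤ 36 * e := by
  set u : Fin 3 → EuclideanSpace ℝ (Fin 3) := fun i => T.points i.succ - T.points 0 with hu
  set p := T.points 0 with hp
  have key : ∀ i j k : Fin 3, |polarForm v (u i) (u j) (u k)| ≤ 36 * e := by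
    intro i j k
    have hmem : ∀ α β γ : ℝ, 0 ≤ α → 0 ≤ β → 0 ≤ γ → α + β + γ ≤ 1 →
        p + α • u i + β • u j + γ • u k ∈ solid T := by
      intro α β γ hα hβ hγ hle
      have := vertex_add_edges_mem_solid T
        (a := Pi.single i α + Pi.single j β + Pi.single k γ)
        (fun l => by
          have h1 : (0 : Fin 3 → ℝ) ≤ Pi.single i α := Pi.single_nonneg.mpr hα
          have h2 : (0 : Fin 3 → ℝ) ≤ Pi.single j β := Pi.single_nonneg.mpr hβ
          have h3 : (0 : Fin 3 → ℝ) ≤ Pi.single k γ := Pi.single_nonneg.mpr hγ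
          exact add_nonneg (add_nonneg (h1 l) (h2 l)) (h3 l))
        (by simpa [Finset.sum_add_distrib] using hle)
      convert this using 1
      simp only [Pi.add_apply, add_smul, Finset.sum_add_distrib, Pi.single_apply, ite_smul,
        zero_smul, Finset.sum_ite_eq', Finset.mem_univ, if_true, add_assoc, hu, hp]
    -- Steps of one third keep all eight points in the solid even when i = j = k. The eight values
    -- are at most e in size, so the polar form is at most 8e · 27/6 = 36e.
    have hdiff : thirdDiff (fun z => polyFun (ternaryCubic v) z - polyFun q z) p
        ((1 / 3 : ℝ) • u i) ((1 / 3 : ℝ) • u j) ((1 / 3 : ℝ) • u k)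
        = 6 / 27 * polarForm v (u i) (u j) (u k) := by
      have h1 := thirdDiff_ternaryCubic v p ((1 / 3 : ℝ) • u i) ((1 / 3 : ℝ) • u j)
        ((1 / 3 : ℝ) • u k)
      have h2 := thirdDiff_of_totalDegree_le hq p ((1 / 3 : ℝ) • u i) ((1 / 3 : ℝ) • u j)
        ((1 / 3 : ℝ) • u k)
      have h3 : polarForm v ((1 / 3 : ℝ) • u i).ofLp ((1 / 3 : ℝ) • u j).ofLp ((1 / 3 : ℝ) • u k).ofLp
          = 1 / 27 * polarForm v (u i) (u j) (u k) := by
        simp only [polarForm, PiLp.smul_apply, smul_eq_mul]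
        ring
      rw [h3] at h1
      unfold thirdDiff at h1 h2 ⊢
      linarith
    have hpt : ∀ α β γ : ℝ, 0 ≤ α → 0 ≤ β → 0 ≤ γ → α + β + γ ≤ 1 →
        -e ≤ polyFun (ternaryCubic v) (p + α • u i + β • u j + γ • u k)
            - polyFun q (p + α • u i + β • u j + γ • u k) ∧
          polyFun (ternaryCubic v) (p + α • u i + β • u j + γ • u k)
            - polyFun q (p + α • u i + β • u j + γ • u k) ≤ e :=
      fun α β γ hα hβ hγ hle => abs_le.mp (he _ (hmem α β γ hα hβ hγ hle))
    have b0 := hpt 0 0 0 (by norm_num) (by norm_num) (by norm_num) (by norm_num)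
    have b1 := hpt (1 / 3) 0 0 (by norm_num) (by norm_num) (by norm_num) (by norm_num)
    have b2 := hpt 0 (1 / 3) 0 (by norm_num) (by norm_num) (by norm_num) (by norm_num)
    have b3 := hpt 0 0 (1 / 3) (by norm_num) (by norm_num) (by norm_num) (by norm_num)
    have b4 := hpt (1 / 3) (1 / 3) 0 (by norm_num) (by norm_num) (by norm_num) (by norm_num)
    have b5 := hpt (1 / 3) 0 (1 / 3) (by norm_num) (by norm_num) (by norm_num) (by norm_num)
    have b6 := hpt 0 (1 / 3) (1 / 3) (by norm_num) (by norm_num) (by norm_num) (by norm_num)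
    have b7 := hpt (1 / 3) (1 / 3) (1 / 3) (by norm_num) (by norm_num) (by norm_num) (by norm_num)
    simp only [zero_smul, add_zero] at b0 b1 b2 b3 b4 b5 b6
    unfold thirdDiff at hdiff
    rw [abs_le]
    constructor <;>
      linarith [b0.1, b1.1, b2.1, b3.1, b4.1, b5.1, b6.1, b7.1,
        b0.2, b1.2, b2.2, b3.2, b4.2, b5.2, b6.2, b7.2]
  have he0 : 0 ≤ 36 * e := (abs_nonneg _).trans (key 0 0 0)
  rw [pi_norm_le_iff_of_nonneg he0]
  unfold cubicAct
  simp only [Fin.forall_fin_succ, Matrix.cons_val_zero, Matrix.cons_val_succ, Real.norm_eq_abs]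
  exact ⟨key 0 0 0, key 1 1 1, key 2 2 2, key 0 0 1, key 0 0 2, key 0 1 1, key 1 1 2, key 0 2 2,
    key 1 2 2, key 0 1 2, fun i => i.elim0⟩

/-- The image of the standard simplex under an invertible matrix. -/
noncomputable def matrixSimplex (B : Matrix (Fin 3) (Fin 3) ℝ) (hB : B.det ≠ 0) :
    Affine.Simplex ℝ (EuclideanSpace ℝ (Fin 3)) 3 :=
  ⟨Matrix.toEuclideanLin B ∘ standardVertices,
    affineIndependent_standardVertices.map' (Matrix.toEuclideanLin B).toAffineMap (by
      have : LinearMap.det (Matrix.toEuclideanLin B) ≠ 0 := by rwa [LinearMap.det_toLpLin]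
      exact (LinearMap.equivOfDetNeZero _ this).injective)⟩

theorem edgeMatrix_matrixSimplex (B : Matrix (Fin 3) (Fin 3) ℝ) (hB : B.det ≠ 0) :
    edgeMatrix (matrixSimplex B hB) = B := by
  ext i j
  simp [edgeMatrix, matrixSimplex, standardVertices]

/-- Interpolation commutes with linear maps: the standard interpolant of π∘B, composed with B⁻¹,
interpolates π on the image simplex with the same pointwise error. -/
theorem exists_interpolant_matrixSimplex (v : Fin 10 → ℝ) (B : Matrix (Fin 3) (Fin 3) ℝ)
    (hB : B.det ≠ 0) : ∃ q : MvPolynomial (Fin 3) ℝ,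
      IsLagrangeInterpolant 3 (matrixSimplex B hB) (polyFun (ternaryCubic v)) q ∧
      ∀ z ∈ solid (matrixSimplex B hB),
        |polyFun (ternaryCubic v) z - polyFun q z| ≤ 50 * ‖cubicAct v B‖ := by
  set w := cubicAct v B with hw
  have hcomp : ∀ y : EuclideanSpace ℝ (Fin 3),
      polyFun (ternaryCubic v) (Matrix.toEuclideanLin B y) = polyFun (ternaryCubic w) y := by
    intro y
    rw [← polyFun_compMatrix, compMatrix_ternaryCubic]
  have hq : ∀ y : EuclideanSpace ℝ (Fin 3),
      polyFun (compMatrix (standardInterpolant w) B⁻¹) (Matrix.toEuclideanLin B y)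
        = polyFun (standardInterpolant w) y := by
    intro y
    rw [← polyFun_compMatrix, ← compMatrix_mul, Matrix.nonsing_inv_mul _ (isUnit_iff_ne_zero.mpr hB),
      polyFun_compMatrix, Matrix.toLpLin_one, LinearMap.id_apply]
  refine ⟨compMatrix (standardInterpolant w) B⁻¹, ⟨?_, ?_⟩, ?_⟩
  · exact (totalDegree_compMatrix_le _ _).trans (totalDegree_standardInterpolant_le w)
  · rintro γ ⟨k, hk, rfl⟩
    set y : EuclideanSpace ℝ (Fin 3) :=
      ∑ i, ((k i : ℝ) / ((3 - 1 : ℕ) : ℝ)) • standardVertices i with hy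
    have hBy : ∑ i, ((k i : ℝ) / ((3 - 1 : ℕ) : ℝ)) • (matrixSimplex B hB).points i
        = Matrix.toEuclideanLin B y := by
      rw [hy, map_sum]
      simp only [map_smul]
      rfl
    have hyi : ∀ j : Fin 3, y j = k j.succ / 2 := by
      intro j
      rw [hy, Fin.sum_univ_succ]
      simp [standardVertices, Pi.single_apply]
    rw [hBy, hq, hcomp]
    refine standardInterpolant_eq_at_node w y (i := k 1) (j := k 2) (k := k 3) ?_
      (hyi 0) (hyi 1) (hyi 2)
    rw [Fin.sum_univ_four] at hk
    omega
  · intro z hz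
    have himg : solid (matrixSimplex B hB)
        = Matrix.toEuclideanLin B '' solid standardSimplex := by
      rw [solid, solid, (Matrix.toEuclideanLin B).image_convexHull, ← Set.range_comp]
      rfl
    rw [himg] at hz
    obtain ⟨y, hy, rfl⟩ := hz
    rw [hq, hcomp]
    exact abs_sub_standardInterpolant_le w
      (fun i => (mem_Icc_of_mem_solid_standardSimplex hy i).1)
      (fun i => (mem_Icc_of_mem_solid_standardSimplex hy i).2)

/-- The set of interpolation errors whose infimum is the shape function. -/
def interpolationErrors (π : MvPolynomial (Fin 3) ℝ) : Set ℝ :=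
  {e : ℝ | ∃ T : Affine.Simplex ℝ (EuclideanSpace ℝ (Fin 3)) 3, volume (solid T) = 1 ∧
    ∃ q : MvPolynomial (Fin 3) ℝ, IsLagrangeInterpolant 3 T (polyFun π) q ∧
      e = (eLpNorm (fun z => polyFun π z - polyFun q z) ∞ (volume.restrict (solid T))).toReal}

theorem shapeFunction_eq_sInf (π : MvPolynomial (Fin 3) ℝ) :
    shapeFunction 3 3 π = sInf (interpolationErrors π) := rfl

theorem interpolationErrors_nonneg {π : MvPolynomial (Fin 3) ℝ} {e : ℝ}
    (he : e ∈ interpolationErrors π) : 0 ≤ e := by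
  obtain ⟨T, -, q, -, rfl⟩ := he
  exact ENNReal.toReal_nonneg

theorem exists_interpolationErrors_le : ∃ C : ℝ, 0 < C ∧ ∀ (v : Fin 10 → ℝ)
    (g : Matrix (Fin 3) (Fin 3) ℝ), g.det = 1 →
      ∃ e ∈ interpolationErrors (ternaryCubic v), e ≤ C * ‖cubicAct v g‖ := by
  set κ := (volume (solid standardSimplex)).toReal with hκ
  have hκ0 : 0 < κ := volume_solid_standardSimplex_pos
  -- The scale s gives s • g determinant κ⁻¹, so the image of the standard simplex has volume one;
  -- the value of κ is never needed.
  obtain ⟨s, hs⟩ := exists_cube_root κ⁻¹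
  refine ⟨50 * κ⁻¹, by positivity, fun v g hg => ?_⟩
  have hdet : (s • g).det = κ⁻¹ := by
    rw [Matrix.det_smul, Fintype.card_fin, hs, hg, mul_one]
  have hB : (s • g).det ≠ 0 := by
    rw [hdet]
    positivity
  have hvol : volume (solid (matrixSimplex (s • g) hB)) = 1 := by
    rw [volume_solid_eq, edgeMatrix_matrixSimplex, hdet, abs_of_pos (by positivity),
      ← ENNReal.ofReal_toReal (isCompact_solid standardSimplex).measure_lt_top.ne, ← hκ,
      ← ENNReal.ofReal_mul (by positivity), inv_mul_cancel₀ hκ0.ne', ENNReal.ofReal_one]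
  obtain ⟨q, hq, hle⟩ := exists_interpolant_matrixSimplex v (s • g) hB
  refine ⟨_, ⟨_, hvol, q, hq, rfl⟩, ?_⟩
  have hw : ‖cubicAct v (s • g)‖ = κ⁻¹ * ‖cubicAct v g‖ := by
    rw [cubicAct_smul_matrix, hs, norm_smul, Real.norm_of_nonneg (by positivity)]
  rw [hw, ← mul_assoc] at hle
  refine ENNReal.toReal_le_of_le_ofReal (by positivity) ?_
  rw [eLpNorm_exponent_top]
  exact eLpNormEssSup_le_of_ae_bound
    (ae_restrict_of_forall_mem (isCompact_solid _).measurableSet hle)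

theorem exists_aronholdHeight_le_interpolationErrors : ∃ K : ℝ, 0 < K ∧ ∀ (v : Fin 10 → ℝ),
    ∀ e ∈ interpolationErrors (ternaryCubic v), aronholdHeight v ≤ K * e ^ 12 := by
  obtain ⟨M, hM, hMle⟩ := exists_aronholdHeight_le
  set κ := (volume (solid standardSimplex)).toReal with hκ
  have hκ0 : 0 < κ := volume_solid_standardSimplex_pos
  refine ⟨κ ^ 12 * M * 36 ^ 12, by positivity, ?_⟩
  rintro v e he
  have he0 := interpolationErrors_nonneg he
  obtain ⟨T, hvol, q, ⟨hq, -⟩, rfl⟩ := he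
  set e := (eLpNorm (fun z => polyFun (ternaryCubic v) z - polyFun q z) ∞
    (volume.restrict (solid T))).toReal
  have hdet : |(edgeMatrix T).det| * κ = 1 := by
    rw [volume_solid_eq] at hvol
    have := congrArg ENNReal.toReal hvol
    rwa [ENNReal.toReal_mul, ENNReal.toReal_ofReal (abs_nonneg _), ENNReal.toReal_one] at this
  have hA : ‖cubicAct v (edgeMatrix T)‖ ≤ 36 * e :=
    norm_cubicAct_edgeMatrix_le T v hq fun z hz => abs_le_toReal_eLpNorm_solid T
      ((continuous_polyFun _).sub (continuous_polyFun _)) hz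
  calc aronholdHeight v = (|(edgeMatrix T).det| * κ) ^ 12 * aronholdHeight v := by
        rw [hdet, one_pow, one_mul]
    _ = κ ^ 12 * aronholdHeight (cubicAct v (edgeMatrix T)) := by
        rw [aronholdHeight_cubicAct]
        ring
    _ ≤ κ ^ 12 * (M * ‖cubicAct v (edgeMatrix T)‖ ^ 12) := by
        gcongr
        exact hMle _
    _ ≤ κ ^ 12 * (M * (36 * e) ^ 12) := by gcongr
    _ = κ ^ 12 * M * 36 ^ 12 * e ^ 12 := by ring

/-! ### Comparison of the shape function with the height -/

theorem mul_pow_twelve_rpow {K y : ℝ} (hK : 0 ≤ K) (hy : 0 ≤ y) :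
    (K * y ^ 12) ^ (1 / 12 : ℝ) = K ^ (1 / 12 : ℝ) * y := by
  rw [Real.mul_rpow hK (by positivity), one_div]
  congr 1
  exact_mod_cast Real.pow_rpow_inv_natCast hy (n := 12) (by norm_num)

theorem mainTheorem8 :
    (∃ c C : ℝ, 0 < c ∧ c ≤ C ∧
      ∀ π : MvPolynomial (Fin 3) ℝ, π.IsHomogeneous 3 →
        c * (|aronholdS π| ^ 3 + aronholdT π ^ 2) ^ (1 / 12 : ℝ) ≤ shapeFunction 3 3 π ∧
        shapeFunction 3 3 π ≤ C * (|aronholdS π| ^ 3 + aronholdT π ^ 2) ^ (1 / 12 : ℝ)) ∧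
    IsCompatiblePair 3 3 := by
  refine ⟨?_, isCompatiblePair_three_three⟩
  obtain ⟨K, hK, hlow⟩ := exists_aronholdHeight_le_interpolationErrors
  obtain ⟨C, hC, hup⟩ := exists_interpolationErrors_le
  obtain ⟨δ, hδ, horb⟩ := exists_cubicAct_norm_le
  set c : ℝ := (K ^ (1 / 12 : ℝ))⁻¹ with hc
  have hK' : 0 < K ^ (1 / 12 : ℝ) := by positivity
  refine ⟨c, max c (C * (δ ^ (1 / 12 : ℝ))⁻¹), by positivity, le_max_left _ _, fun π hπ => ?_⟩
  set v := normCoeffs π with hv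
  have hheight : |aronholdS π| ^ 3 + aronholdT π ^ 2 = aronholdHeight v := rfl
  rw [hheight, shapeFunction_eq_sInf, ← ternaryCubic_normCoeffs hπ, ← hv]
  have h0 := aronholdHeight_nonneg v
  have hbdd : BddBelow (interpolationErrors (ternaryCubic v)) :=
    ⟨0, fun e he => interpolationErrors_nonneg he⟩
  constructor
  -- The real infimum of an empty set is 0, so a lower bound needs an actual simplex.
  · obtain ⟨e, he, -⟩ := hup v 1 Matrix.det_one
    refine le_csInf ⟨e, he⟩ fun e he => ?_
    have he0 := interpolationErrors_nonneg he
    rw [hc, inv_mul_le_iff₀ hK', ← mul_pow_twelve_rpow hK.le he0]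
    exact Real.rpow_le_rpow h0 (hlow v e he) (by norm_num)
  · refine le_trans ?_ (mul_le_mul_of_nonneg_right (le_max_right _ _) (by positivity))
    -- If the bound fails, the infimum is positive, so infimum / C is an admissible ε. An orbit
    -- element of smaller norm would give an error below the infimum, which leaves only the height
    -- estimate.
    by_contra hlt
    rw [not_le] at hlt
    have hpos : 0 < sInf (interpolationErrors (ternaryCubic v)) :=
      lt_of_le_of_lt (by positivity) hlt
    obtain ⟨g, hg, hcase⟩ := horb v (sInf (interpolationErrors (ternaryCubic v)) / C)
      (div_pos hpos hC)
    obtain ⟨e, he, hle⟩ := hup v g hg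
    have hinf := (csInf_le hbdd he).trans hle
    rcases hcase with hsmall | hbig
    · rw [lt_div_iff₀ hC] at hsmall
      linarith
    · have h1 := Real.rpow_le_rpow (by positivity) hbig (by norm_num : (0 : ℝ) ≤ 1 / 12)
      rw [mul_pow_twelve_rpow hδ.le (norm_nonneg _)] at h1
      have h2 : ‖cubicAct v g‖ ≤ (δ ^ (1 / 12 : ℝ))⁻¹ * aronholdHeight v ^ (1 / 12 : ℝ) := by
        rwa [le_inv_mul_iff₀ (by positivity)]
      have h3 := mul_le_mul_of_nonneg_left h2 hC.le
      rw [← mul_assoc] at h3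
      linarith
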